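/- Let $(\mathbb X,\mathcal X)$ be a measurable space with a $\sigma$-finite measure $\lambda$, and for each $t>0$ let $\eta_t$ be a Poisson process on $\mathbb X$ with intensity measure $t\lambda$ (a random integer-valued $\sigma$-finite measure on $\mathbb X$), all defined on one probability space. For an integer-valued $\sigma$-finite measure $\mu$ let $\mu^{(m)}$ be its $m$-th factorial measure on $\mathbb X^m$, $$\mu^{(m)}(B)=\int\!\cdots\!\int \mathbf 1_B(x_1,\dots,x_m)\Big(\mu-\sum_{j=1}^{m-1}\delta_{x_j}\Big)(dx_m)\cdots(\mu-\delta_{x_1})(dx_2)\,\mu(dx_1),$$ so that integrating against $\mu^{(m)}$ for $\mu=\sum_{i\in I}\delta_{x_i}$ means summing over all $m$-tuples of pairwise distinct indices. Let $\ell\in\mathbb N$. For $i=1,\dots,\ell$ let $m_i\ge 1$ be an integer, let $f^{(i)}:\mathbb X^{m_i}\to\mathbb R$ be measurable, symmetric and integrable with respect to $\lambda^{m_i}$, and let $g_i:(0,\infty)\to\mathbb R$ satisfy $g_i(t)\neq 0$ for all sufficiently large $t$. Put $$F^{(i)}_t=g_i(t)\int f^{(i)}\,d\eta_t^{(m_i)},\qquad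 \hat F^{(i)}_t=g_i(t)^{-1}t^{-(m_i-1/2)}\big(F^{(i)}_t-\mathbb E F^{(i)}_t\big),$$ (with the convention $0^{-1}=0$ for the irrelevant $t$ with $g_i(t)=0$), and $$f^{(i)}_1(x)=m_i\int f^{(i)}(x,y_1,\dots,y_{m_i-1})\,\lambda^{m_i-1}(d(y_1,\dots,y_{m_i-1})),\qquad C_{ij}=\int f^{(i)}_1f^{(j)}_1\,d\lambda .$$ For $n_1,\dots,n_k\in\mathbb N$ and $n=n_1+\dots+n_k$ divide $[n]=\{1,\dots,n\}$ into the consecutive rows $J_1,\dots,J_k$ of sizes $n_1,\dots,n_k$, and let $\Pi(n_1,\dots,n_k)$ be the set of non-flat partitions, that is, of all partitions $\sigma$ of $[n]$ each of whose blocks contains at most one element of each row. For such $\sigma$ and functions $h_j:\mathbb X^{n_j}\to\mathbb R$ let $(\otimes_{j=1}^k h_j)_\sigma:\mathbb X^{|\sigma|}\to\mathbb R$ be obtained from $\otimes_{j=1}^k h_j:\mathbb X^n\to\mathbb R$ by identifying the arguments that belong to the same block of $\sigma$. Assume that for all $k\ge 1$, all $i_1,\dots,i_k\in\{1,\dots,\ell\}$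 and all $\sigma\in\Pi(m_{i_1},\dots,m_{i_k})$, $$\int \big(\otimes_{j=1}^k |f^{(i_j)}|\big)_\sigma\,d\lambda^{|\sigma|}<\infty .$$ Then $\lim_{t\to\infty}\operatorname{Cov}\big(\hat F^{(i)}_t,\hat F^{(j)}_t\big)=C_{ij}$ for all $i,j\in\{1,\dots,\ell\}$, and, as $t\to\infty$, the random vector $\big(\hat F^{(1)}_t,\dots,\hat F^{(\ell)}_t\big)$ converges in distribution to $N$, where $N$ is an $\ell$-dimensional centred Gaussian random vector with covariance matrix $(C_{ij})_{i,j=1,\dots,\ell}$. -/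

import Mathlib

open MeasureTheory ProbabilityTheory Filter Topology
open scoped ENNReal

noncomputable section

namespace PoissonU

/-! ### Point processes and factorial measures -/

section PointProc

variable {𝕏 : Type*} [MeasurableSpace 𝕏] {Ω : Type*} [MeasurableSpace Ω]

/-- `μ` takes values in `{0, 1, 2, …} ∪ {∞}`. -/
def IsIntegerValued (μ : Measure 𝕏) : Prop :=
  ∀ B, MeasurableSet B → μ B = ∞ ∨ ∃ n : ℕ, μ B = n

/-- `η` is a Poisson process on `𝕏` with intensity measure `Λ`: a random element of the space of
integer-valued `σ`-finite measures (the `σ`-field on `Measure 𝕏` is the smallest one making all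
maps `μ ↦ μ B`, `B` measurable, measurable) such that `η(B)` is Poisson distributed with parameter
`Λ(B)` for every measurable `B` (almost surely `∞` if `Λ(B) = ∞`), and `η(B₁), …, η(Bₙ)` are
independent for pairwise disjoint measurable `B₁, …, Bₙ`. -/
structure IsPoissonProcess (η : Ω → Measure 𝕏) (Λ : Measure 𝕏) (P : Measure Ω) : Prop where
  measurable : Measurable η
  integerValued : ∀ ω, IsIntegerValued (η ω)
  sigmaFinite : ∀ ω, SigmaFinite (η ω)
  law : ∀ B, MeasurableSet B → Λ B ≠ ∞ →
    P.map (fun ω ↦ η ω B) = (poissonMeasure (Λ B).toNNReal).map (fun n : ℕ ↦ (n : ℝ≥0∞))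
  law_top : ∀ B, MeasurableSet B → Λ B = ∞ → ∀ᵐ ω ∂P, η ω B = ∞
  indep : ∀ (n : ℕ) (B : Fin n → Set 𝕏), (∀ i, MeasurableSet (B i)) →
    Pairwise (Function.onFun Disjoint B) → iIndepFun (fun i ω ↦ η ω (B i)) P

/-- The `m`-th factorial measure `μ^{(m)}` on `𝕏 ^ m` of an integer-valued `σ`-finite measure `μ`,
i.e. the iterated integral
`μ^{(m)}(B) = ∫ ⋯ ∫ 1_B(x₁, …, xₘ) (μ - ∑_{j < m} δ_{x_j})(dxₘ) ⋯ (μ - δ_{x₁})(dx₂) μ(dx₁)`.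
Its `m - 1` outer integrations are the integration with respect to `μ^{(m-1)}`, and the innermost
one integrates `xₘ` first against `μ`, which gives the product measure `μ^{(m-1)} ⊗ μ`, and
subtracts, for each `j < m`, the image of `μ^{(m-1)}` under
`(x₁, …, x_{m-1}) ↦ (x₁, …, x_{m-1}, x_j)`.
For `μ = ∑_{i ∈ I} δ_{x_i}` this is the sum of the Dirac measures at `(x_{i₁}, …, x_{iₘ})` over all
`m`-tuples of pairwise distinct indices in `I`. -/
def factorialMeasure (μ : Measure 𝕏) : (m : ℕ) → Measure (Fin m → 𝕏)
  | 0 => Measure.dirac Fin.elim0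
  | m + 1 =>
    ((factorialMeasure μ m).prod μ).map (fun p ↦ (Fin.snoc p.1 p.2 : Fin (m + 1) → 𝕏))
      - ∑ j : Fin m, (factorialMeasure μ m).map (fun x ↦ (Fin.snoc x (x j) : Fin (m + 1) → 𝕏))

/-- The Poisson U-statistic `F_t = g(t) ∫ f dη_t^{(m)}`; here `c = g(t)` and `η = η_t`. -/
def uStat {m : ℕ} (c : ℝ) (f : (Fin m → 𝕏) → ℝ) (η : Ω → Measure 𝕏) (ω : Ω) : ℝ :=
  c * ∫ x, f x ∂(factorialMeasure (η ω) m)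

/-- The normalized U-statistic `g(t)⁻¹ t^{-(m - 1/2)} (F_t - 𝔼 F_t)`; here `c = g(t)`. -/
def normalizedUStat {m : ℕ} (P : Measure Ω) (t c : ℝ) (f : (Fin m → 𝕏) → ℝ)
    (η : Ω → Measure 𝕏) (ω : Ω) : ℝ :=
  c⁻¹ * t ^ (-((m : ℝ) - 1 / 2)) * (uStat c f η ω - ∫ ω', uStat c f η ω' ∂P)

/-- `f ∈ L¹_s(λ^m)`: measurable, symmetric and integrable functions on `𝕏 ^ m`. -/
structure IsL1Sym (Λ : Measure 𝕏) {m : ℕ} (f : (Fin m → 𝕏) → ℝ) : Prop where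
  measurable : Measurable f
  symm : ∀ (e : Equiv.Perm (Fin m)) (x : Fin m → 𝕏), f (x ∘ e) = f x
  integrable : Integrable f (Measure.pi fun _ ↦ Λ)

/-- The kernel
`f_n(x₁, …, xₙ) = (m choose n) ∫ f(x₁, …, xₙ, y₁, …, y_{m-n}) λ^{m-n}(d(y₁, …, y_{m-n}))`
for `n ≤ m`. -/
def kernelFn (Λ : Measure 𝕏) {m : ℕ} (f : (Fin m → 𝕏) → ℝ) (n : ℕ) (x : Fin n → 𝕏) : ℝ :=
  (m.choose n : ℝ) *
    ∫ y : Fin (m - n) → 𝕏,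
      f (fun a ↦ if h : a.1 < n then x ⟨a.1, h⟩ else y ⟨a.1 - n, by omega⟩)
      ∂(Measure.pi fun _ ↦ Λ)

/-- `C_{ij} = ∫ f₁^{(i)} f₁^{(j)} dλ`. -/
def asympCov (Λ : Measure 𝕏) {ℓ : ℕ} {m : Fin ℓ → ℕ} (f : (i : Fin ℓ) → (Fin (m i) → 𝕏) → ℝ)
    (i j : Fin ℓ) : ℝ :=
  ∫ x, kernelFn Λ (f i) 1 (fun _ ↦ x) * kernelFn Λ (f j) 1 (fun _ ↦ x) ∂Λ

end PointProc

/-! ### Non-flat partitions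

The set `[n₁ + ⋯ + n_k]` with its rows `J₁, …, J_k` of sizes `n₁, …, n_k` is represented by the
type of pairs `(j, a)`, `j ∈ [k]`, `a ∈ [n_j]`. -/

section Partitions

variable {𝕏 : Type*} {k : ℕ} {n : Fin k → ℕ}

/-- The disjoint union of rows of sizes `n₁, …, n_k`. -/
abbrev Diagram (n : Fin k → ℕ) : Type := Σ j : Fin k, Fin (n j)

/-- The `j`-th row of the diagram. -/
def row (n : Fin k → ℕ) (j : Fin k) : Finset (Diagram n) :=
  Finset.univ.filter fun p ↦ p.1 = j

/-- `σ ∈ Π(n₁, …, n_k)`: every block of `σ` meets every row in at most one element. -/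
def IsNonFlat (σ : Finpartition (Finset.univ : Finset (Diagram n))) : Prop :=
  ∀ j, ∀ J ∈ σ.parts, (row n j ∩ J).card ≤ 1

/-- `f_σ : 𝕏 ^ |σ| → ℝ`, obtained from `f` by identifying the arguments in a common block of `σ`;
the coordinates of `𝕏 ^ |σ|` are indexed by the blocks of `σ`. -/
def identify (f : (Diagram n → 𝕏) → ℝ) (σ : Finpartition (Finset.univ : Finset (Diagram n)))
    (y : σ.parts → 𝕏) : ℝ :=
  f fun p ↦ y ⟨σ.part p, σ.part_mem.2 (Finset.mem_univ p)⟩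

/-- The tensor product `⊗_j f_j`. -/
def tensor (f : (j : Fin k) → (Fin (n j) → 𝕏) → ℝ) (x : Diagram n → 𝕏) : ℝ :=
  ∏ j, f j fun a ↦ x ⟨j, a⟩

end Partitions

end PoissonU

end

/-!
The proof computes second moments of Poisson U-statistics exactly and transfers the central limit
theorem from linear statistics to U-statistics by approximation in `L²`.

*Points.* On a general measurable space an integer-valued `σ`-finite measure need not be a sum of
Dirac measures, but it is a countable sum of probability measures with values in `{0, 1}`
(`IsIntegerValued.exists_sum`). These behave like points, because sampling one of them twice cannot
be told from repeating a single sample (`map_comp_pi_zeroOne`). Hence the factorial measure is the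
sum over tuples of pairwise distinct indices (`factorialMeasure_eq_distinctTuples`), and the product
of two factorial measures is a sum over the non-flat partitions of two rows, encoded as partial
matchings (`factorialMeasure_prod`).

*Covariances.* The mean measure of the `m`-th factorial measure of a Poisson process is the `m`-th
power of the intensity measure (`IsPoissonProcess.lintegral_factorialMeasure`); on boxes with equal
or disjoint sides this is the formula for the factorial moments of the Poisson distribution.
Together with the product formula it writes the covariance of two U-statistics as a sum over the
partial matchings with at least one matched pair, the term of a matching being a constant times `t`
to the number of its blocks (`IsPoissonProcess.covariance_eq`). After normalization only the
matchings with exactly one pair survive as `t → ∞`, and by Fubini's theorem they add up to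
`∫ f₁ h₁ dλ` (`tendsto_covariance_normalizedUStat`).

*Limit theorem.* For `v ∈ ℝ^ℓ` put `u = ∑ᵢ vᵢ f₁⁽ⁱ⁾`, which lies in `L²(λ)`. For an integrable
simple function `w` the compensated integrals `t^{-1/2} (∫ w dη_t - t ∫ w dλ)` have explicit
characteristic functions, which converge to that of a centred Gaussian variable with variance
`∫ w² dλ` (`tendsto_integral_cexp_simpleFunc`). Such an integral is itself a normalized U-statistic
of order one, so the covariance limits give
`𝔼 (∑ᵢ vᵢ F̂⁽ⁱ⁾_t - t^{-1/2} (∫ w dη_t - t ∫ w dλ))² → ∫ (u - w)² dλ` (`tendsto_integral_sq_sub`).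
Letting `w → u` in `L²(λ)`, the characteristic function of `∑ᵢ vᵢ F̂⁽ⁱ⁾_t` at `1` converges to
`exp (-∫ u² dλ / 2)` (`tendsto_integral_cexp`), and Lévy's continuity theorem concludes.
-/

noncomputable section

namespace PoissonU

/-! ### Integer-valued measures as sums of zero-one measures -/

section ZeroOne

variable {𝕏 : Type*} [MeasurableSpace 𝕏]

lemma IsIntegerValued.restrict {μ : Measure 𝕏} (hμ : IsIntegerValued μ) {A : Set 𝕏}
    (hA : MeasurableSet A) : IsIntegerValued (μ.restrict A) := fun B hB ↦ by
  rw [Measure.restrict_apply hB]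
  exact hμ _ (hB.inter hA)

/-- A finite integer-valued measure is a finite sum of zero-one measures: a measurable set of
minimal positive mass `k` carries `k` copies of a zero-one measure, and its complement has smaller
total mass. -/
lemma IsIntegerValued.exists_list (N : ℕ) (μ : Measure 𝕏) (hμ : IsIntegerValued μ)
    (hN : μ Set.univ = N) :
    ∃ L : List (Measure 𝕏), (∀ ν ∈ L, IsZeroOneMeasure ν ∧ IsProbabilityMeasure ν) ∧
      μ = L.sum := by
  induction N using Nat.strong_induction_on generalizing μ with
  | _ N ih =>
  have hfin (B : Set 𝕏) : μ B ≠ ∞ :=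
    ne_top_of_le_ne_top (by simp [hN]) (measure_mono (Set.subset_univ B))
  rcases Nat.eq_zero_or_pos N with rfl | hpos
  · exact ⟨[], by simp, by simpa using! hN⟩
  classical
  -- by minimality of `k`, a measurable subset of a set `A` of mass `k` has mass `0` or `k`
  have hex : ∃ k : ℕ, 0 < k ∧ ∃ A, MeasurableSet A ∧ μ A = k :=
    ⟨N, hpos, Set.univ, MeasurableSet.univ, hN⟩
  set k := Nat.find hex with hk
  obtain ⟨kpos, A, hA, hAk⟩ : 0 < k ∧ ∃ A, MeasurableSet A ∧ μ A = k := Nat.find_spec hex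
  have hk0 : (k : ℝ≥0∞) ≠ 0 := by exact_mod_cast kpos.ne'
  set ν : Measure 𝕏 := (k : ℝ≥0∞)⁻¹ • μ.restrict A with hν
  have hν1 : IsZeroOneMeasure ν := ⟨fun B hB ↦ by
    simp only [hν, Measure.smul_apply, Measure.restrict_apply hB, smul_eq_mul]
    rcases hμ _ (hB.inter hA) with h | ⟨j, hj⟩
    · exact absurd h (hfin _)
    rcases Nat.eq_zero_or_pos j with rfl | hjpos
    · simp [hj]
    · have h1 : k ≤ j := Nat.find_min' hex ⟨hjpos, _, hB.inter hA, hj⟩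
      have h2 : j ≤ k := by
        have := measure_mono (μ := μ) (Set.inter_subset_right : B ∩ A ⊆ A)
        rw [hj, hAk] at this
        exact_mod_cast this
      obtain rfl : j = k := le_antisymm h2 h1
      right
      rw [hj, ENNReal.inv_mul_cancel hk0 (by simp)]⟩
  have hν2 : IsProbabilityMeasure ν := ⟨by
    simp only [hν, Measure.smul_apply, Measure.restrict_apply_univ, smul_eq_mul, hAk]
    exact ENNReal.inv_mul_cancel hk0 (by simp)⟩
  have hkν : k • ν = μ.restrict A := by
    ext B hB
    simp only [hν, Measure.smul_apply, smul_eq_mul, nsmul_eq_mul]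
    rw [← mul_assoc, ENNReal.mul_inv_cancel hk0 (by simp), one_mul]
  have hkN : k ≤ N := Nat.find_min' hex ⟨hpos, Set.univ, MeasurableSet.univ, hN⟩
  have hcompl : μ.restrict Aᶜ Set.univ = ((N - k : ℕ) : ℝ≥0∞) := by
    rw [Measure.restrict_apply_univ, measure_compl hA (hfin A), hN, hAk]
    simp
  obtain ⟨L, hL, hsum⟩ := ih (N - k) (by omega) _ (hμ.restrict hA.compl) hcompl
  refine ⟨List.replicate k ν ++ L, ?_, ?_⟩
  · intro ν' hν'
    rcases List.mem_append.1 hν' with h | h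
    · rw [List.eq_of_mem_replicate h]
      exact ⟨hν1, hν2⟩
    · exact hL _ h
  · rw [List.sum_append, List.sum_replicate, ← hsum, hkν, Measure.restrict_add_restrict_compl hA]

/-- A `σ`-finite integer-valued measure is a countable sum of zero-one probability measures. On a
Borel space these are Dirac measures; on a general measurable space they play the role of the
points of the measure. -/
lemma IsIntegerValued.exists_sum {μ : Measure 𝕏} [SigmaFinite μ] (hμ : IsIntegerValued μ) :
    ∃ (ι : Type) (_ : Countable ι) (ν : ι → Measure 𝕏), (∀ i, IsZeroOneMeasure (ν i)) ∧
      (∀ i, IsProbabilityMeasure (ν i)) ∧ μ = Measure.sum ν := by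
  let D : ℕ → Set 𝕏 := disjointed (spanningSets μ)
  have hD (n : ℕ) : MeasurableSet (D n) :=
    MeasurableSet.disjointed (fun i ↦ measurableSet_spanningSets μ i) n
  have key (n : ℕ) : ∃ L : List (Measure 𝕏),
      (∀ ν ∈ L, IsZeroOneMeasure ν ∧ IsProbabilityMeasure ν) ∧ μ.restrict (D n) = L.sum := by
    have hfin : μ (D n) ≠ ∞ :=
      ((measure_mono (disjointed_subset _ n)).trans_lt (measure_spanningSets_lt_top μ n)).ne
    rcases hμ _ (hD n) with h | ⟨N, hN⟩
    · exact absurd h hfin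
    · exact IsIntegerValued.exists_list N _ (hμ.restrict (hD n))
        (by rw [Measure.restrict_apply_univ, hN])
  choose L hL hsum using key
  refine ⟨Σ n, Fin (L n).length, inferInstance, fun p ↦ (L p.1).get p.2,
    fun p ↦ (hL _ _ (List.get_mem _ _)).1, fun p ↦ (hL _ _ (List.get_mem _ _)).2, ?_⟩
  have h1 : μ = Measure.sum fun n ↦ μ.restrict (D n) := by
    rw [← Measure.restrict_iUnion (disjoint_disjointed _) hD, iUnion_disjointed,
      iUnion_spanningSets, Measure.restrict_univ]
  ext B hB
  conv_lhs => rw [h1]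
  rw [Measure.sum_apply _ hB, Measure.sum_apply _ hB, ENNReal.tsum_sigma']
  refine tsum_congr fun n ↦ ?_
  rw [hsum, tsum_fintype, ← Measure.finsetSum_apply]
  congr 1
  simp

variable {S S' : Type*} [Fintype S] [Fintype S']

/-- For zero-one measures a repeated coordinate and two independent coordinates with the same law
cannot be distinguished. -/
lemma map_comp_pi_zeroOne (ν : S' → Measure 𝕏) [∀ s, IsZeroOneMeasure (ν s)]
    [∀ s, IsProbabilityMeasure (ν s)] (q : S → S') :
    (Measure.pi ν).map (fun y s ↦ y (q s)) = Measure.pi fun s ↦ ν (q s) := by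
  classical
  symm
  refine Measure.pi_eq fun B hB ↦ ?_
  have hmeas : Measurable fun (y : S' → 𝕏) (s : S) ↦ y (q s) := by fun_prop
  rw [Measure.map_apply hmeas (MeasurableSet.univ_pi hB)]
  have hset : (fun (y : S' → 𝕏) (s : S) ↦ y (q s)) ⁻¹' Set.univ.pi B
      = Set.univ.pi fun s' ↦ ⋂ s ∈ Finset.univ.filter (fun s ↦ q s = s'), B s := by
    ext y
    simp only [Set.mem_preimage, Set.mem_pi, Set.mem_univ, true_imp_iff, Set.mem_iInter,
      Finset.mem_filter, Finset.mem_univ, true_and]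
    exact ⟨fun h s' s hs ↦ hs ▸ h s, fun h s ↦ h _ s rfl⟩
  have hinter (s' : S') (F : Finset S) : ν s' (⋂ s ∈ F, B s) = ∏ s ∈ F, ν s' (B s) := by
    induction F using Finset.induction_on with
    | empty => simp
    | insert a F ha ih =>
      rw [Finset.set_biInter_insert, IsZeroOneMeasure.measure_inter_eq_prod (hB a)
        (Finset.measurableSet_biInter _ fun s _ ↦ hB s), ih, Finset.prod_insert ha]
  rw [hset, Measure.pi_pi]
  simp_rw [hinter]
  rw [← Finset.prod_fiberwise Finset.univ q]
  refine Finset.prod_congr rfl fun s' _ ↦ Finset.prod_congr rfl fun s hs ↦ ?_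
  rw [(Finset.mem_filter.1 hs).2]

lemma measurePreserving_comp_equiv (ν : S' → Measure 𝕏) [∀ s, SigmaFinite (ν s)] (e : S ≃ S') :
    MeasurePreserving (fun (y : S' → 𝕏) (s : S) ↦ y (e s)) (Measure.pi ν)
      (Measure.pi fun s ↦ ν (e s)) := by
  have hmeas : Measurable fun (y : S' → 𝕏) (s : S) ↦ y (e s) := by fun_prop
  refine ⟨hmeas, (Measure.pi_eq fun B hB ↦ ?_).symm⟩
  rw [Measure.map_apply hmeas (MeasurableSet.univ_pi hB)]
  have : (fun (y : S' → 𝕏) (s : S) ↦ y (e s)) ⁻¹' Set.univ.pi B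
      = Set.univ.pi fun s' ↦ B (e.symm s') := by
    ext y
    simp only [Set.mem_preimage, Set.mem_pi, Set.mem_univ, true_imp_iff]
    exact ⟨fun h s' ↦ by simpa using h (e.symm s'), fun h s ↦ by simpa using h (e s)⟩
  rw [this, Measure.pi_pi, ← e.prod_comp]
  simp

end ZeroOne

/-! ### Factorial measures of sums of zero-one measures -/

section DistinctTuples

variable {𝕏 : Type*} [MeasurableSpace 𝕏] {ι : Type*} (ν : ι → Measure 𝕏)

/-- For `μ = ∑ᵢ νᵢ`, the sum of the product measures `⨂ₛ ν_{c(s)}` over all families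
`(c(s))_{s ∈ S}` of pairwise distinct indices. -/
def distinctTuples (S : Type*) [Fintype S] : Measure (S → 𝕏) :=
  Measure.sum fun c : S ↪ ι ↦ Measure.pi fun s ↦ ν (c s)

lemma tsum_embedding_eq {S : Type*} (X : (S → ι) → ℝ≥0∞)
    [DecidablePred (Function.Injective (α := S) (β := ι))] :
    ∑' c : S ↪ ι, X c = ∑' c : S → ι, if Function.Injective c then X c else 0 := by
  classical
  rw [← (Equiv.subtypeInjectiveEquivEmbedding S ι).tsum_eq (fun c : S ↪ ι ↦ X c)]
  rw [show (fun c : S → ι ↦ if Function.Injective c then X c else 0)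
    = Set.indicator {c | Function.Injective c} X from by
      ext c; simp [Set.indicator_apply]]
  rw [← tsum_subtype]
  rfl

lemma distinctTuples_reindex {S S' : Type*} [Fintype S] [Fintype S']
    [∀ i, IsProbabilityMeasure (ν i)] (e : S ≃ S') :
    (distinctTuples ν S').map (fun y s ↦ y (e s)) = distinctTuples ν S := by
  have hmeas : Measurable fun (y : S' → 𝕏) (s : S) ↦ y (e s) := by fun_prop
  ext C hC
  rw [Measure.map_apply hmeas hC, distinctTuples, distinctTuples,
    Measure.sum_apply _ (hmeas hC), Measure.sum_apply _ hC,
    ← (e.embeddingCongr (Equiv.refl ι)).tsum_eq]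
  refine tsum_congr fun c ↦ ?_
  rw [← Measure.map_apply hmeas hC, (measurePreserving_comp_equiv _ e).map_eq]
  simp

lemma measurable_snoc {m : ℕ} :
    Measurable fun p : (Fin m → 𝕏) × 𝕏 ↦ (Fin.snoc p.1 p.2 : Fin (m + 1) → 𝕏) := by
  refine measurable_pi_lambda _ fun i ↦ ?_
  refine Fin.lastCases ?_ (fun j ↦ ?_) i
  · simpa using measurable_snd
  · simp only [Fin.snoc_castSucc]
    exact (measurable_pi_apply j).comp measurable_fst

lemma measurable_snoc_apply {m : ℕ} (j : Fin m) :
    Measurable fun x : Fin m → 𝕏 ↦ (Fin.snoc x (x j) : Fin (m + 1) → 𝕏) :=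
  measurable_snoc.comp (measurable_id.prodMk (measurable_pi_apply j))

lemma map_snoc_pi {m : ℕ} (ν' : Fin m → Measure 𝕏) (ν'' : Measure 𝕏)
    [∀ i, IsProbabilityMeasure (ν' i)] [IsProbabilityMeasure ν''] :
    ((Measure.pi ν').prod ν'').map (fun p ↦ (Fin.snoc p.1 p.2 : Fin (m + 1) → 𝕏))
      = Measure.pi (Fin.snoc ν' ν'' : Fin (m + 1) → Measure 𝕏) := by
  have : ∀ i, IsProbabilityMeasure ((Fin.snoc ν' ν'' : Fin (m + 1) → Measure 𝕏) i) := by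
    intro i
    refine Fin.lastCases ?_ (fun j ↦ ?_) i
    · rw [Fin.snoc_last]; infer_instance
    · rw [Fin.snoc_castSucc]; infer_instance
  symm
  refine Measure.pi_eq fun B hB ↦ ?_
  rw [Measure.map_apply measurable_snoc (MeasurableSet.univ_pi hB)]
  have : (fun p : (Fin m → 𝕏) × 𝕏 ↦ (Fin.snoc p.1 p.2 : Fin (m + 1) → 𝕏)) ⁻¹' Set.univ.pi B
      = (Set.univ.pi fun i : Fin m ↦ B i.castSucc) ×ˢ B (Fin.last m) := by
    ext p
    simp [Set.mem_pi, Fin.forall_fin_succ']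
  rw [this, Measure.prod_prod, Measure.pi_pi, Fin.prod_univ_castSucc]
  simp

end DistinctTuples

section Factorial

variable {𝕏 : Type*} [MeasurableSpace 𝕏]

/-- The recursion of factorial measures in additive form: choosing a further index and
sorting according to whether it is new or equal to an earlier one. -/
lemma map_snoc_distinctTuples_prod {ι : Type*} [Countable ι] (ν : ι → Measure 𝕏)
    [∀ i, IsZeroOneMeasure (ν i)] [∀ i, IsProbabilityMeasure (ν i)] (m : ℕ) :
    ((distinctTuples ν (Fin m)).prod (Measure.sum ν)).map
        (fun p ↦ (Fin.snoc p.1 p.2 : Fin (m + 1) → 𝕏))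
      = distinctTuples ν (Fin (m + 1)) + ∑ j : Fin m, (distinctTuples ν (Fin m)).map
          (fun x ↦ (Fin.snoc x (x j) : Fin (m + 1) → 𝕏)) := by
  classical
  ext C hC
  set X : (Fin (m + 1) → ι) → ℝ≥0∞ := fun c ↦ Measure.pi (fun s ↦ ν (c s)) C with hX
  have hsnoc (c : Fin m → ι) (i : ι) :
      (Fin.snoc (fun s ↦ ν (c s)) (ν i) : Fin (m + 1) → Measure 𝕏)
        = fun s ↦ ν ((Fin.snoc c i : Fin (m + 1) → ι) s) := by
    ext1 s
    refine Fin.lastCases ?_ (fun k ↦ ?_) s <;> simp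
  have h1 (c : Fin m → ι) (i : ι) :
      ((Measure.pi fun s ↦ ν (c s)).prod (ν i))
        ((fun p ↦ (Fin.snoc p.1 p.2 : Fin (m + 1) → 𝕏)) ⁻¹' C) = X (Fin.snoc c i) := by
    rw [← Measure.map_apply measurable_snoc hC, map_snoc_pi, hsnoc]
  -- a repeated coordinate is replaced by a second sample from the same zero-one measure
  have h2 (c : Fin m → ι) (j : Fin m) :
      (Measure.pi fun s ↦ ν (c s)) ((fun x ↦ (Fin.snoc x (x j) : Fin (m + 1) → 𝕏)) ⁻¹' C)
        = X (Fin.snoc c (c j)) := by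
    rw [← Measure.map_apply (measurable_snoc_apply j) hC]
    have := map_comp_pi_zeroOne (fun s ↦ ν (c s)) (Fin.snoc id j : Fin (m + 1) → Fin m)
    have e1 : (fun (y : Fin m → 𝕏) (s : Fin (m + 1)) ↦ y ((Fin.snoc id j : Fin (m + 1) → Fin m) s))
        = fun x ↦ (Fin.snoc x (x j) : Fin (m + 1) → 𝕏) := by
      ext y s
      refine Fin.lastCases ?_ (fun k ↦ ?_) s <;> simp
    have e2 : (fun s : Fin (m + 1) ↦ ν (c ((Fin.snoc id j : Fin (m + 1) → Fin m) s)))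
        = fun s ↦ ν ((Fin.snoc c (c j) : Fin (m + 1) → ι) s) := by
      ext1 s
      refine Fin.lastCases ?_ (fun k ↦ ?_) s <;> simp
    rw [e1, e2] at this
    rw [this]
  have hL : ((distinctTuples ν (Fin m)).prod (Measure.sum ν)).map
        (fun p ↦ (Fin.snoc p.1 p.2 : Fin (m + 1) → 𝕏)) C
      = ∑' c : Fin m → ι, ∑' i, if Function.Injective c then X (Fin.snoc c i) else 0 := by
    rw [Measure.map_apply measurable_snoc hC, distinctTuples, Measure.prod_sum,
      Measure.sum_apply _ (measurable_snoc hC), ENNReal.tsum_prod']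
    rw [show (∑' (c : Fin m ↪ ι) (i : ι), ((Measure.pi fun s ↦ ν (c s)).prod (ν i))
        ((fun p ↦ (Fin.snoc p.1 p.2 : Fin (m + 1) → 𝕏)) ⁻¹' C))
        = ∑' (c : Fin m ↪ ι) (i : ι), X (Fin.snoc c i) from
      tsum_congr fun c ↦ tsum_congr fun i ↦ h1 c i,
      tsum_embedding_eq (fun c ↦ ∑' i, X (Fin.snoc c i))]
    refine tsum_congr fun c ↦ ?_
    split_ifs <;> simp
  have hR1 : distinctTuples ν (Fin (m + 1)) C
      = ∑' c : Fin m → ι, ∑' i, if Function.Injective c ∧ i ∉ Set.range c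
          then X (Fin.snoc c i) else 0 := by
    rw [distinctTuples, Measure.sum_apply _ hC, tsum_embedding_eq X,
      ← (Fin.snocEquiv fun _ ↦ ι).tsum_eq, ENNReal.tsum_prod', ENNReal.tsum_comm]
    refine tsum_congr fun c ↦ tsum_congr fun i ↦ ?_
    change (if Function.Injective (Fin.snoc c i : Fin (m + 1) → ι) then X (Fin.snoc c i) else 0) = _
    simp only [Fin.snoc_injective_iff]
  have hR2 (j : Fin m) : (distinctTuples ν (Fin m)).map
          (fun x ↦ (Fin.snoc x (x j) : Fin (m + 1) → 𝕏)) C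
      = ∑' c : Fin m → ι, ∑' i, if Function.Injective c ∧ i = c j
          then X (Fin.snoc c i) else 0 := by
    rw [Measure.map_apply (measurable_snoc_apply j) hC, distinctTuples,
      Measure.sum_apply _ (measurable_snoc_apply j hC)]
    rw [show (∑' c : Fin m ↪ ι, (Measure.pi fun s ↦ ν (c s))
        ((fun x ↦ (Fin.snoc x (x j) : Fin (m + 1) → 𝕏)) ⁻¹' C))
        = ∑' c : Fin m ↪ ι, X (Fin.snoc c (c j)) from tsum_congr fun c ↦ h2 c j,
      tsum_embedding_eq (fun c ↦ X (Fin.snoc c (c j)))]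
    refine tsum_congr fun c ↦ ?_
    by_cases hc : Function.Injective c <;> simp [hc, tsum_ite_eq]
  rw [Measure.add_apply, Measure.finsetSum_apply, hL, hR1]
  simp_rw [hR2]
  rw [← Summable.tsum_finsetSum fun _ _ ↦ ENNReal.summable, ← ENNReal.tsum_add]
  refine tsum_congr fun c ↦ ?_
  rw [← Summable.tsum_finsetSum fun _ _ ↦ ENNReal.summable, ← ENNReal.tsum_add]
  refine tsum_congr fun i ↦ ?_
  by_cases hc : Function.Injective c
  swap
  · simp [hc]
  by_cases hi : i ∈ Set.range c
  · obtain ⟨j, rfl⟩ := hi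
    simp [hc, hc.eq_iff]
  · have : ∀ j, i ≠ c j := fun j h ↦ hi ⟨j, h.symm⟩
    simp [hc, hi, this]

lemma distinctTuples_box_lt_top {ι : Type*} [Countable ι] (ν : ι → Measure 𝕏)
    [∀ i, IsZeroOneMeasure (ν i)] [∀ i, IsProbabilityMeasure (ν i)] {K : Set 𝕏}
    (hK : MeasurableSet K) (hfin : Measure.sum ν K < ∞) (m : ℕ) :
    distinctTuples ν (Fin m) (Set.univ.pi fun _ ↦ K) < ∞ := by
  have : ∀ i, SFinite (ν i) := inferInstance
  induction m with
  | zero =>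
    rw [distinctTuples, Measure.sum_apply _ (MeasurableSet.univ_pi fun _ ↦ hK)]
    have : Unique (Fin 0 ↪ ι) := ⟨⟨⟨Fin.elim0, fun i ↦ i.elim0⟩⟩, fun _ ↦ by ext i; exact i.elim0⟩
    rw [tsum_fintype]
    simp
  | succ m ih =>
    have h := congrArg (fun M ↦ M (Set.univ.pi fun _ ↦ K)) (map_snoc_distinctTuples_prod ν m)
    simp only [Measure.add_apply] at h
    refine lt_of_le_of_lt (le_self_add.trans_eq h.symm) ?_
    rw [Measure.map_apply measurable_snoc (MeasurableSet.univ_pi fun _ ↦ hK)]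
    have : (fun p : (Fin m → 𝕏) × 𝕏 ↦ (Fin.snoc p.1 p.2 : Fin (m + 1) → 𝕏)) ⁻¹'
        (Set.univ.pi fun _ ↦ K) = (Set.univ.pi fun _ : Fin m ↦ K) ×ˢ K := by
      ext p
      simp [Set.mem_pi, Fin.forall_fin_succ']
    rw [this, Measure.prod_prod]
    exact ENNReal.mul_lt_top ih hfin

/-- Subtraction of measures cancels a summand that is finite on an exhausting sequence. -/
lemma measure_add_sub_cancel_of_spanning {α : Type*} [MeasurableSpace α] (A B : Measure α)
    (K : ℕ → Set α) (hmono : Monotone K)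
    (huniv : ⋃ n, K n = Set.univ) (hB : ∀ n, B (K n) ≠ ∞) : A + B - B = A := by
  refine le_antisymm (Measure.sub_le_of_le_add le_rfl) ?_
  rw [Measure.sub_def]
  refine le_sInf fun d hd ↦ ?_
  refine Measure.le_iff.2 fun s hs ↦ ?_
  have h1 (M : Measure α) : M s = ⨆ n, M (s ∩ K n) := by
    rw [← Directed.measure_iUnion, ← Set.inter_iUnion, huniv, Set.inter_univ]
    exact Monotone.directed_le fun i j hij ↦ Set.inter_subset_inter_right s (hmono hij)
  rw [h1 A, h1 d]
  refine iSup_mono fun n ↦ ?_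
  have h2 : (A + B) (s ∩ K n) ≤ (d + B) (s ∩ K n) := hd _
  rw [Measure.add_apply, Measure.add_apply] at h2
  exact (ENNReal.add_le_add_iff_right
    (ne_top_of_le_ne_top (hB n) (measure_mono Set.inter_subset_right))).1 h2

/-- The factorial measure of a sum of zero-one measures is the sum over tuples of pairwise
distinct indices. -/
theorem factorialMeasure_eq_distinctTuples {ι : Type*} [Countable ι] (ν : ι → Measure 𝕏)
    [∀ i, IsZeroOneMeasure (ν i)] [∀ i, IsProbabilityMeasure (ν i)] {μ : Measure 𝕏}
    [SigmaFinite μ] (hμ : μ = Measure.sum ν) (m : ℕ) :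
    factorialMeasure μ m = distinctTuples ν (Fin m) := by
  induction m with
  | zero =>
    have : Unique (Fin 0 ↪ ι) := ⟨⟨⟨Fin.elim0, fun i ↦ i.elim0⟩⟩, fun _ ↦ by ext i; exact i.elim0⟩
    rw [factorialMeasure, distinctTuples]
    ext C hC
    rw [Measure.sum_apply _ hC, tsum_fintype]
    simp only [Finset.univ_unique, Finset.sum_singleton]
    rw [Measure.pi_of_empty _ Fin.elim0]
  | succ m ih =>
    rw [factorialMeasure, ih]
    conv_lhs => rw [hμ]
    rw [map_snoc_distinctTuples_prod]
    have hbox (n : ℕ) : MeasurableSet (Set.univ.pi fun _ : Fin (m + 1) ↦ spanningSets μ n) :=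
      MeasurableSet.univ_pi fun _ ↦ measurableSet_spanningSets μ n
    -- subtraction of measures is an infimum; it undoes addition as the subtrahend is finite on boxes
    refine measure_add_sub_cancel_of_spanning _ _
      (fun n ↦ Set.univ.pi fun _ ↦ spanningSets μ n)
      (fun i j hij ↦ Set.pi_mono fun _ _ ↦ monotone_spanningSets μ hij) ?_ fun n ↦ ?_
    · rw [Set.iUnion_univ_pi_of_monotone fun _ ↦ monotone_spanningSets μ]
      simp [iUnion_spanningSets]
    · rw [Measure.finsetSum_apply]
      refine (ENNReal.sum_lt_top.2 fun j _ ↦ ?_).ne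
      rw [Measure.map_apply (measurable_snoc_apply j) (hbox n)]
      refine (measure_mono ?_).trans_lt (distinctTuples_box_lt_top ν
        (measurableSet_spanningSets μ n) (hμ ▸ measure_spanningSets_lt_top μ n) m)
      intro x hx
      simp only [Set.mem_preimage, Set.mem_pi, Set.mem_univ, true_imp_iff] at hx ⊢
      intro i
      simpa using hx i.castSucc

/-- The additive recursion of factorial measures, without subtraction of measures. -/
lemma map_snoc_factorialMeasure_prod {μ : Measure 𝕏} [SigmaFinite μ] (hμ : IsIntegerValued μ)
    (m : ℕ) :
    ((factorialMeasure μ m).prod μ).map (fun p ↦ (Fin.snoc p.1 p.2 : Fin (m + 1) → 𝕏))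
      = factorialMeasure μ (m + 1) + ∑ j : Fin m, (factorialMeasure μ m).map
          (fun x ↦ (Fin.snoc x (x j) : Fin (m + 1) → 𝕏)) := by
  obtain ⟨ι, _, ν, h1, h2, h⟩ := hμ.exists_sum
  rw [factorialMeasure_eq_distinctTuples ν h, factorialMeasure_eq_distinctTuples ν h,
    ← map_snoc_distinctTuples_prod, ← h]

end Factorial

/-! ### The product of two factorial measures -/

section Glue

variable {S T : Type*}

/-- A partial matching of `T` with `S`: `φ b = some a` says that `b` is matched with `a`, and no
element of `S` is matched twice. These are the non-flat partitions of two rows `S` and `T`. -/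
def IsMatching (φ : T → Option S) : Prop :=
  ∀ ⦃b b' a⦄, φ b = some a → φ b' = some a → b = b'

/-- The set of blocks of the non-flat partition of `S ⊕ T` described by a partial matching. -/
abbrev Glue (φ : T → Option S) : Type _ := S ⊕ {b : T // φ b = none}

/-- The block of an element of `T`. -/
def glue (φ : T → Option S) (b : T) : Glue φ :=
  match h : φ b with
  | some a => Sum.inl a
  | none => Sum.inr ⟨b, h⟩

lemma glue_of_some {φ : T → Option S} {b : T} {a : S} (h : φ b = some a) :
    glue φ b = Sum.inl a := by
  unfold glue
  split <;> simp_all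

lemma glue_of_none {φ : T → Option S} {b : T} (h : φ b = none) :
    glue φ b = Sum.inr ⟨b, h⟩ := by
  unfold glue
  split <;> simp_all

lemma glue_eq_inl_iff {φ : T → Option S} {b : T} {a : S} :
    glue φ b = Sum.inl a ↔ φ b = some a := by
  refine ⟨fun h ↦ ?_, glue_of_some⟩
  cases h' : φ b with
  | none => simp [glue_of_none h'] at h
  | some a' => rw [glue_of_some h'] at h; simpa using h

lemma IsMatching.glue_injective {φ : T → Option S} (hφ : IsMatching φ) :
    Function.Injective (glue φ) := by
  intro b b' h
  cases hb : φ b with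
  | some a =>
    rw [glue_of_some hb] at h
    exact hφ hb (glue_eq_inl_iff.1 h.symm)
  | none =>
    cases hb' : φ b' with
    | some a => rw [glue_of_none hb, glue_of_some hb'] at h; simp at h
    | none => rw [glue_of_none hb, glue_of_none hb'] at h; simpa using h

/-- The coordinate projections of a family indexed by blocks to the two rows. -/
def unglue {𝕏 : Type*} (φ : T → Option S) (y : Glue φ → 𝕏) : (S → 𝕏) × (T → 𝕏) :=
  (fun a ↦ y (Sum.inl a), fun b ↦ y (glue φ b))

lemma measurable_unglue {𝕏 : Type*} [MeasurableSpace 𝕏] (φ : T → Option S) :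
    Measurable (unglue (𝕏 := 𝕏) φ) := by
  unfold unglue
  fun_prop

instance [Finite S] [Finite T] : Fintype {φ : T → Option S // IsMatching φ} := Fintype.ofFinite _

instance [Fintype T] (φ : T → Option S) : Fintype {b : T // φ b = none} :=
  @Subtype.fintype _ _ (fun _ ↦ decidable_of_iff _ Option.isNone_iff_eq_none) _

/-- Two injective families of indices amount to the partial matching that records the
coincidences between them and one injective family indexed by its blocks. -/
def glueEmbedding {ι : Type*} (p : Σ φ : {φ : T → Option S // IsMatching φ}, Glue φ.1 ↪ ι) :
    (S ↪ ι) × (T ↪ ι) :=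
  (Function.Embedding.inl.trans p.2,
    (⟨glue p.1.1, p.1.2.glue_injective⟩ : T ↪ Glue p.1.1).trans p.2)

lemma glueEmbedding_bijective {ι : Type*} :
    Function.Bijective (glueEmbedding (S := S) (T := T) (ι := ι)) := by
  classical
  constructor
  · rintro ⟨⟨φ, hφ⟩, d⟩ ⟨⟨φ', hφ'⟩, d'⟩ h
    simp only [glueEmbedding, Prod.mk.injEq] at h
    have h1 (a : S) : d (Sum.inl a) = d' (Sum.inl a) := DFunLike.congr_fun h.1 a
    have h2 (b : T) : d (glue φ b) = d' (glue φ' b) := DFunLike.congr_fun h.2 b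
    obtain rfl : φ = φ' := by
      ext b a
      rw [← glue_eq_inl_iff, ← glue_eq_inl_iff, ← d.injective.eq_iff,
        ← d'.injective.eq_iff, h1, h2]
    obtain rfl : d = d' := by
      ext x
      rcases x with a | ⟨b, hb⟩
      · exact h1 a
      · rw [← glue_of_none hb]; exact h2 b
    rfl
  · rintro ⟨c, c'⟩
    let φ : T → Option S := fun b ↦ if h : ∃ a, c a = c' b then some h.choose else none
    have hφ1 {b : T} {a : S} (h : φ b = some a) : c a = c' b := by
      simp only [φ] at h
      split_ifs at h with h'
      rw [← Option.some.inj h]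
      exact h'.choose_spec
    have hφ2 {b : T} (h : φ b = none) (a : S) : c a ≠ c' b := by
      intro h'
      have : ∃ a, c a = c' b := ⟨a, h'⟩
      simp [φ, this] at h
    have hφ : IsMatching φ := fun b b' a h h' ↦ c'.injective ((hφ1 h).symm.trans (hφ1 h'))
    refine ⟨⟨⟨φ, hφ⟩, ⟨Sum.elim c fun b ↦ c' b.1, ?_⟩⟩, ?_⟩
    · rintro (a | ⟨b, hb⟩) (a' | ⟨b', hb'⟩) h
      · simpa using h
      · exact absurd h (hφ2 hb' a)
      · exact absurd h.symm (hφ2 hb a')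
      · simpa using h
    · simp only [glueEmbedding]
      ext x
      · rfl
      · change Sum.elim c (fun b ↦ c' b.1) (glue φ x) = c' x
        cases hx : φ x with
        | some a => rw [glue_of_some hx]; exact hφ1 hx
        | none => rw [glue_of_none hx]; rfl

variable {𝕏 : Type*} [MeasurableSpace 𝕏] [Fintype S] [Fintype T]

lemma distinctTuples_prod {ι : Type*} [Countable ι] (ν : ι → Measure 𝕏)
    [∀ i, IsZeroOneMeasure (ν i)] [∀ i, IsProbabilityMeasure (ν i)] :
    (distinctTuples ν S).prod (distinctTuples ν T)
      = ∑ φ : {φ : T → Option S // IsMatching φ},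
        (distinctTuples ν (Glue φ.1)).map (unglue φ.1) := by
  have key (φ : T → Option S) (d : Glue φ → ι) :
      (Measure.pi fun s ↦ ν (d s)).map (unglue φ)
        = (Measure.pi fun a ↦ ν (d (Sum.inl a))).prod (Measure.pi fun b ↦ ν (d (glue φ b))) := by
    have h1 := map_comp_pi_zeroOne (fun s ↦ ν (d s)) (Sum.elim Sum.inl (glue φ) : S ⊕ T → Glue φ)
    have h2 := (measurePreserving_sumPiEquivProdPi (X := fun _ : S ⊕ T ↦ 𝕏)
      fun s ↦ ν (d ((Sum.elim Sum.inl (glue φ) : S ⊕ T → Glue φ) s))).map_eq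
    rw [← h1, Measure.map_map (MeasurableEquiv.measurable _) (by fun_prop)] at h2
    exact h2
  have : Countable (T ↪ ι) := DFunLike.coe_injective.countable
  ext C hC
  rw [Measure.finsetSum_apply, distinctTuples, distinctTuples, Measure.prod_sum,
    Measure.sum_apply _ hC, ← (Equiv.ofBijective _ glueEmbedding_bijective).tsum_eq,
    ENNReal.tsum_sigma', tsum_fintype]
  refine Finset.sum_congr rfl fun φ _ ↦ ?_
  rw [Measure.map_apply (measurable_unglue _) hC, distinctTuples,
    Measure.sum_apply _ (measurable_unglue _ hC)]
  refine tsum_congr fun d ↦ ?_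
  rw [← Measure.map_apply (measurable_unglue _) hC, key]
  rfl

/-- The factorial measure of `μ` on `𝕏 ^ S` for a finite index set `S`, transported along an
arbitrary enumeration of `S`. -/
def factorialMeasureOn (μ : Measure 𝕏) (S : Type*) [Fintype S] : Measure (S → 𝕏) :=
  (factorialMeasure μ (Fintype.card S)).map fun x s ↦ x (Fintype.equivFin S s)

/-- The product formula for factorial measures: a product of two of them is the sum over the
non-flat partitions `φ` of the two rows of the factorial measures on the blocks of `φ`. -/
theorem factorialMeasure_prod {μ : Measure 𝕏} [SigmaFinite μ] (hμ : IsIntegerValued μ)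
    (m n : ℕ) :
    (factorialMeasure μ m).prod (factorialMeasure μ n)
      = ∑ φ : {φ : Fin n → Option (Fin m) // IsMatching φ},
        (factorialMeasureOn μ (Glue φ.1)).map (unglue φ.1) := by
  obtain ⟨ι, _, ν, h1, h2, h⟩ := hμ.exists_sum
  simp only [factorialMeasureOn, factorialMeasure_eq_distinctTuples ν h, distinctTuples_reindex]
  exact distinctTuples_prod ν

end Glue

/-! ### The multivariate Mecke formula -/

section Mecke

/-- The falling factorial `x (x - 1) ⋯ (x - k + 1)` on `[0, ∞]`. The subtraction is truncated, which
does no harm for integers `x`: a factor vanishes if `x < k`. -/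
def fallingFactorial (k : ℕ) (x : ℝ≥0∞) : ℝ≥0∞ := ∏ j ∈ Finset.range k, (x - j)

lemma fallingFactorial_succ (k : ℕ) (x : ℝ≥0∞) :
    fallingFactorial (k + 1) x = fallingFactorial k x * (x - k) := by
  rw [fallingFactorial, Finset.prod_range_succ, fallingFactorial]

lemma measurable_fallingFactorial (k : ℕ) : Measurable (fallingFactorial k) := by
  unfold fallingFactorial
  fun_prop

lemma fallingFactorial_natCast (k n : ℕ) :
    fallingFactorial k (n : ℝ≥0∞) = (n.descFactorial k : ℕ) := by
  induction k with
  | zero => simp [fallingFactorial]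
  | succ k ih =>
    rw [fallingFactorial_succ, ih, Nat.descFactorial_succ]
    push_cast
    rw [mul_comm]

/-- The factorial moments of the Poisson distribution. -/
lemma lintegral_fallingFactorial_poissonMeasure (r : NNReal) (k : ℕ) :
    ∫⁻ n : ℕ, fallingFactorial k n ∂(poissonMeasure r) = (r : ℝ≥0∞) ^ k := by
  rw [lintegral_countable']
  simp only [fallingFactorial_natCast]
  have shift (u : ℕ → ℝ≥0∞) (hu : ∀ n < k, u n = 0) : ∑' n, u n = ∑' n, u (n + k) := by
    rw [← Summable.sum_add_tsum_nat_add' (f := u) (k := k) ENNReal.summable,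
      Finset.sum_eq_zero fun n hn ↦ hu n (Finset.mem_range.1 hn), zero_add]
  rw [shift _ fun n hn ↦ by rw [Nat.descFactorial_of_lt hn, Nat.cast_zero, zero_mul]]
  have h (n : ℕ) : (((n + k).descFactorial k : ℕ) : ℝ≥0∞) * poissonMeasure r {n + k}
      = (r : ℝ≥0∞) ^ k * poissonMeasure r {n} := by
    rw [poissonMeasure_singleton, poissonMeasure_singleton, ← ENNReal.ofReal_natCast,
      ← ENNReal.ofReal_mul (Nat.cast_nonneg _), ← ENNReal.ofReal_coe_nnreal,
      ← ENNReal.ofReal_pow r.coe_nonneg, ← ENNReal.ofReal_mul (pow_nonneg r.coe_nonneg _)]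
    congr 1
    have h1 := Nat.factorial_mul_descFactorial (Nat.le_add_left k n)
    rw [Nat.add_sub_cancel] at h1
    rw [← h1, Nat.cast_mul]
    have h2 : ((n + k).descFactorial k : ℝ) ≠ 0 := by
      exact_mod_cast (Nat.descFactorial_pos.2 (Nat.le_add_left k n)).ne'
    have h3 : (n.factorial : ℝ) ≠ 0 := Nat.cast_ne_zero.2 n.factorial_ne_zero
    generalize ((n + k).descFactorial k : ℝ) = a at *
    generalize (n.factorial : ℝ) = b at *
    rw [pow_add]
    field_simp
  rw [tsum_congr h, ENNReal.tsum_mul_left]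
  have : ∑' n : ℕ, poissonMeasure r {n} = 1 := by
    have := lintegral_countable' (μ := poissonMeasure r) (fun _ ↦ 1)
    simpa using this.symm
  rw [this, mul_one]

variable {𝕏 : Type*} [MeasurableSpace 𝕏]

/-- The factorial measure of a box whose sides are either equal or disjoint: a side that occurs `k`
times contributes the `k`-th falling factorial of its mass. -/
lemma factorialMeasure_pi_disjoint {μ : Measure 𝕏} [SigmaFinite μ] (hμ : IsIntegerValued μ)
    {I : Type*} [Fintype I] [DecidableEq I] {A : I → Set 𝕏} (hA : ∀ a, MeasurableSet (A a))
    (hdisj : Pairwise (Function.onFun Disjoint A)) (hfin : ∀ a, μ (A a) ≠ ∞) (m : ℕ)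
    (c : Fin m → I) :
    factorialMeasure μ m (Set.univ.pi fun i ↦ A (c i))
      = ∏ a, fallingFactorial (∑ i, if c i = a then 1 else 0) (μ (A a)) := by
  induction m with
  | zero =>
    have : (Set.univ.pi fun i : Fin 0 ↦ A (c i)) = Set.univ := by
      ext; simp
    rw [this, factorialMeasure]
    simp [fallingFactorial]
  | succ m ih =>
    set c' : Fin m → I := fun i ↦ c i.castSucc with hc'
    set a₀ := c (Fin.last m) with ha₀
    set R : Set (Fin (m + 1) → 𝕏) := Set.univ.pi fun i ↦ A (c i) with hR
    set R' : Set (Fin m → 𝕏) := Set.univ.pi fun i ↦ A (c' i) with hR'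
    have hRm : MeasurableSet R := MeasurableSet.univ_pi fun _ ↦ hA _
    set V := factorialMeasure μ m R' with hV
    have hVfin : V ≠ ∞ := by
      rw [hV, ih c']
      refine ENNReal.prod_ne_top fun a _ ↦ ENNReal.prod_ne_top fun j _ ↦ ?_
      exact ne_top_of_le_ne_top (hfin a) tsub_le_self
    set k : ℕ := ∑ i, if c' i = a₀ then 1 else 0 with hk
    have hrec := congrArg (fun M ↦ M R) (map_snoc_factorialMeasure_prod hμ m)
    simp only [Measure.add_apply, Measure.finsetSum_apply] at hrec
    rw [Measure.map_apply measurable_snoc hRm] at hrec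
    have e1 : (fun p : (Fin m → 𝕏) × 𝕏 ↦ (Fin.snoc p.1 p.2 : Fin (m + 1) → 𝕏)) ⁻¹' R
        = R' ×ˢ A a₀ := by
      ext p
      simp [hR, hR', Set.mem_pi, Fin.forall_fin_succ', hc', ha₀]
    have e2 (j : Fin m) : (factorialMeasure μ m).map
        (fun x ↦ (Fin.snoc x (x j) : Fin (m + 1) → 𝕏)) R = if c' j = a₀ then V else 0 := by
      rw [Measure.map_apply (measurable_snoc_apply j) hRm]
      have e3 : (fun x : Fin m → 𝕏 ↦ (Fin.snoc x (x j) : Fin (m + 1) → 𝕏)) ⁻¹' R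
          = {x | x ∈ R' ∧ x j ∈ A a₀} := by
        ext x
        simp [hR, hR', Set.mem_pi, Fin.forall_fin_succ', hc', ha₀]
      rw [e3]
      split_ifs with h
      · congr 1
        ext x
        simp only [Set.mem_ofPred_eq, and_iff_left_iff_imp]
        intro hx
        rw [← h]
        exact hx j (Set.mem_univ _)
      · convert! measure_empty (μ := factorialMeasure μ m)
        ext x
        simp only [Set.mem_ofPred_eq, Set.mem_empty_iff_false, iff_false, not_and]
        exact fun hx hx' ↦ Set.disjoint_left.1 (hdisj h) (hx j (Set.mem_univ _)) hx'
    rw [e1, Measure.prod_prod] at hrec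
    simp_rw [e2] at hrec
    have e4 : (∑ j, if c' j = a₀ then V else 0) = k * V := by
      rw [hk, Nat.cast_sum, Finset.sum_mul]
      refine Finset.sum_congr rfl fun j _ ↦ ?_
      split_ifs <;> simp
    rw [e4] at hrec
    have hnew : factorialMeasure μ (m + 1) R = V * (μ (A a₀) - k) := by
      -- finiteness of `V` allows the subtraction in `[0, ∞]`
      rw [ENNReal.mul_sub fun _ _ ↦ hVfin]
      refine ENNReal.eq_sub_of_add_eq (ENNReal.mul_ne_top hVfin (by simp)) ?_
      rw [mul_comm V (k : ℝ≥0∞), ← hrec]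
    rw [hnew, hV, ih c']
    have e5 (a : I) : fallingFactorial (∑ i, if c i = a then 1 else 0) (μ (A a))
        = fallingFactorial (∑ i, if c' i = a then 1 else 0) (μ (A a))
          * if a₀ = a then (μ (A a₀) - k) else 1 := by
      rw [Fin.sum_univ_castSucc]
      by_cases h : a₀ = a
      · subst h
        simp only [← ha₀, if_true, fallingFactorial_succ]
        rfl
      · simp only [← ha₀, h, if_false, add_zero, mul_one]
        rfl
    simp_rw [e5]
    rw [Finset.prod_mul_distrib, Finset.prod_ite_eq]
    simp

variable {Ω : Type*} [MeasurableSpace Ω] {P : Measure Ω} {η : Ω → Measure 𝕏} {M : Measure 𝕏}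

namespace IsPoissonProcess

lemma measurable_apply (hη : IsPoissonProcess η M P) {B : Set 𝕏} (hB : MeasurableSet B) :
    Measurable fun ω ↦ η ω B :=
  (Measure.measurable_coe hB).comp hη.measurable

lemma lintegral_fallingFactorial (hη : IsPoissonProcess η M P) {B : Set 𝕏} (hB : MeasurableSet B)
    (hfin : M B ≠ ∞) (k : ℕ) : ∫⁻ ω, fallingFactorial k (η ω B) ∂P = M B ^ k := by
  have h := lintegral_map (μ := P) (measurable_fallingFactorial k) (hη.measurable_apply hB)
  rw [← h, hη.law B hB hfin, lintegral_map (measurable_fallingFactorial k) (by fun_prop),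
    lintegral_fallingFactorial_poissonMeasure, ENNReal.coe_toNNReal hfin]

lemma lintegral_apply (hη : IsPoissonProcess η M P) {B : Set 𝕏} (hB : MeasurableSet B)
    (hfin : M B ≠ ∞) : ∫⁻ ω, η ω B ∂P = M B := by
  simpa [fallingFactorial] using hη.lintegral_fallingFactorial hB hfin 1

lemma ae_apply_ne_top (hη : IsPoissonProcess η M P) {B : Set 𝕏} (hB : MeasurableSet B)
    (hfin : M B ≠ ∞) : ∀ᵐ ω ∂P, η ω B ≠ ∞ := by
  filter_upwards [ae_lt_top (hη.measurable_apply hB) (by rwa [hη.lintegral_apply hB hfin])]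
    with ω hω using hω.ne

lemma iIndepFun_apply (hη : IsPoissonProcess η M P) {I : Type*} [Fintype I] {A : I → Set 𝕏}
    (hA : ∀ a, MeasurableSet (A a)) (hdisj : Pairwise (Function.onFun Disjoint A)) :
    iIndepFun (fun a ω ↦ η ω (A a)) P := by
  have e := Fintype.equivFin I
  have h := hη.indep _ (fun i ↦ A (e.symm i)) (fun _ ↦ hA _)
    fun i j hij ↦ hdisj (e.symm.injective.ne hij)
  simpa using h.precomp e.injective

/-- The mean of the factorial measure of a box whose sides are either equal or disjoint, by
independence and the factorial moments of the Poisson distribution. -/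
lemma lintegral_factorialMeasure_pi_disjoint (hη : IsPoissonProcess η M P)
    {I : Type*} [Fintype I] {A : I → Set 𝕏} (hA : ∀ a, MeasurableSet (A a))
    (hdisj : Pairwise (Function.onFun Disjoint A)) (hfin : ∀ a, M (A a) ≠ ∞) (m : ℕ)
    (c : Fin m → I) :
    AEMeasurable (fun ω ↦ factorialMeasure (η ω) m (Set.univ.pi fun i ↦ A (c i))) P ∧
      ∫⁻ ω, factorialMeasure (η ω) m (Set.univ.pi fun i ↦ A (c i)) ∂P = ∏ i, M (A (c i)) := by
  classical
  set k : I → ℕ := fun a ↦ ∑ i, if c i = a then 1 else 0 with hk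
  have hae : (fun ω ↦ factorialMeasure (η ω) m (Set.univ.pi fun i ↦ A (c i)))
      =ᵐ[P] fun ω ↦ ∏ a, fallingFactorial (k a) (η ω (A a)) := by
    filter_upwards [ae_all_iff.2 fun a ↦ hη.ae_apply_ne_top (hA a) (hfin a)] with ω hω
    have := hη.sigmaFinite ω
    exact factorialMeasure_pi_disjoint (hη.integerValued ω) hA hdisj hω m c
  have hmeas (a : I) : Measurable fun ω ↦ fallingFactorial (k a) (η ω (A a)) :=
    (measurable_fallingFactorial _).comp (hη.measurable_apply (hA a))
  refine ⟨(Finset.measurable_fun_prod _ fun a _ ↦ hmeas a).aemeasurable.congr hae.symm, ?_⟩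
  rw [lintegral_congr_ae hae, lintegral_prod_eq_prod_lintegral_of_indepFun Finset.univ
    (fun a ω ↦ fallingFactorial (k a) (η ω (A a)))
    ((hη.iIndepFun_apply hA hdisj).comp (fun a ↦ fallingFactorial (k a))
      fun a ↦ measurable_fallingFactorial _) hmeas]
  simp_rw [fun a ↦ hη.lintegral_fallingFactorial (hA a) (hfin a) (k a), hk]
  simp_rw [← Finset.prod_pow_eq_pow_sum]
  rw [Finset.prod_comm]
  refine Finset.prod_congr rfl fun i _ ↦ ?_
  rw [Finset.prod_eq_single (c i)]
  · simp
  · intro a _ ha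
    simp [ha.symm]
  · simp

end IsPoissonProcess

/-- The atoms of the finite `σ`-field generated by `B₁, …, Bₘ`. -/
def boolAtom {𝕏 : Type*} {m : ℕ} (B : Fin m → Set 𝕏) (b : Fin m → Bool) : Set 𝕏 :=
  ⋂ i, if b i then B i else (B i)ᶜ

lemma measurableSet_boolAtom {m : ℕ} {B : Fin m → Set 𝕏} (hB : ∀ i, MeasurableSet (B i))
    (b : Fin m → Bool) : MeasurableSet (boolAtom B b) := by
  refine MeasurableSet.iInter fun i ↦ ?_
  split_ifs
  exacts [hB i, (hB i).compl]

open Classical in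
lemma mem_boolAtom {𝕏 : Type*} {m : ℕ} {B : Fin m → Set 𝕏} {b : Fin m → Bool} {x : 𝕏} :
    x ∈ boolAtom B b ↔ b = fun i ↦ decide (x ∈ B i) := by
  simp only [boolAtom, Set.mem_iInter, funext_iff]
  refine forall_congr' fun i ↦ ?_
  cases b i <;> simp

lemma boolAtom_disjoint {𝕏 : Type*} {m : ℕ} (B : Fin m → Set 𝕏) :
    Pairwise (Function.onFun Disjoint (boolAtom B)) := by
  classical
  intro b b' h
  exact Set.disjoint_left.2 fun x hx hx' ↦ h ((mem_boolAtom.1 hx).trans (mem_boolAtom.1 hx').symm)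

/-- The indices of the atoms contained in some `Bᵢ`. The remaining atom, the complement of the
union, is left out because its mass may be infinite. -/
abbrev AtomIndex (m : ℕ) : Type := {b : Fin m → Bool // ∃ i, b i = true}

open Classical in
/-- A box is a disjoint union of boxes whose sides are atoms. -/
lemma measure_pi_eq_sum_boolAtom {m : ℕ} {B : Fin m → Set 𝕏} (hB : ∀ i, MeasurableSet (B i))
    (μ : Measure (Fin m → 𝕏)) :
    μ (Set.univ.pi B) = ∑ c : Fin m → AtomIndex m, if (∀ i, (c i).1 i = true)
      then μ (Set.univ.pi fun i ↦ boolAtom B (c i).1) else 0 := by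
  have hset : Set.univ.pi B = ⋃ c ∈ Finset.univ.filter
      (fun c : Fin m → AtomIndex m ↦ ∀ i, (c i).1 i = true),
      Set.univ.pi fun i ↦ boolAtom B (c i).1 := by
    ext x
    simp only [Set.mem_pi, Set.mem_univ, true_imp_iff, Set.mem_iUnion, Finset.mem_filter,
      Finset.mem_univ, true_and, mem_boolAtom, exists_prop]
    constructor
    · intro hx
      exact ⟨fun i ↦ ⟨fun j ↦ decide (x i ∈ B j), i, by simpa using hx i⟩,
        fun i ↦ by simpa using hx i, fun i ↦ rfl⟩
    · rintro ⟨c, hc, hc'⟩ i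
      have := hc i
      rw [hc' i] at this
      simpa using this
  rw [hset, measure_biUnion_finset, Finset.sum_filter]
  · intro c _ c' _ hcc'
    refine Set.disjoint_left.2 fun x hx hx' ↦ hcc' ?_
    ext1 i
    exact Subtype.ext ((mem_boolAtom.1 (hx i (Set.mem_univ _))).trans
      (mem_boolAtom.1 (hx' i (Set.mem_univ _))).symm)
  · exact fun c _ ↦ MeasurableSet.univ_pi fun i ↦ measurableSet_boolAtom hB _

/-- Passage from nonnegative to real integrands for a random measure `K` with mean measure `N`. -/
lemma integral_randomMeasure {α : Type*} [MeasurableSpace α] {K : Ω → Measure α} {N : Measure α}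
    (h : ∀ F : α → ℝ≥0∞, Measurable F → AEMeasurable (fun ω ↦ ∫⁻ x, F x ∂(K ω)) P ∧
      ∫⁻ ω, ∫⁻ x, F x ∂(K ω) ∂P = ∫⁻ x, F x ∂N)
    {F : α → ℝ} (hF : Measurable F) (hint : Integrable F N) :
    (∀ᵐ ω ∂P, Integrable F (K ω)) ∧ Integrable (fun ω ↦ ∫ x, F x ∂(K ω)) P ∧
      ∫ ω, ∫ x, F x ∂(K ω) ∂P = ∫ x, F x ∂N := by
  have hn := h _ hF.enorm
  have hp := h (fun x ↦ ENNReal.ofReal (F x)) (by fun_prop)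
  have hq := h (fun x ↦ ENNReal.ofReal (-F x)) (by fun_prop)
  have hle (r : ℝ) : ENNReal.ofReal r ≤ ‖r‖ₑ := by
    rw [← ofReal_norm]
    exact ENNReal.ofReal_le_ofReal (le_abs_self r)
  have hle' (r : ℝ) : ENNReal.ofReal (-r) ≤ ‖r‖ₑ := (hle (-r)).trans_eq (enorm_neg r)
  have hpfin : ∫⁻ x, ENNReal.ofReal (F x) ∂N ≠ ∞ :=
    ne_top_of_le_ne_top hint.2.ne (lintegral_mono fun x ↦ hle _)
  have hqfin : ∫⁻ x, ENNReal.ofReal (-F x) ∂N ≠ ∞ :=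
    ne_top_of_le_ne_top hint.2.ne (lintegral_mono fun x ↦ hle' _)
  have hae : ∀ᵐ ω ∂P, Integrable F (K ω) := by
    filter_upwards [ae_lt_top' hn.1 (by rw [hn.2]; exact hint.2.ne)] with ω hω
    exact ⟨hF.aestronglyMeasurable, hω⟩
  have heq : (fun ω ↦ ∫ x, F x ∂(K ω)) =ᵐ[P] fun ω ↦
      (∫⁻ x, ENNReal.ofReal (F x) ∂(K ω)).toReal
        - (∫⁻ x, ENNReal.ofReal (-F x) ∂(K ω)).toReal := by
    filter_upwards [hae] with ω hω
    exact integral_eq_lintegral_pos_part_sub_lintegral_neg_part hω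
  have hpi := integrable_toReal_of_lintegral_ne_top hp.1 (by rwa [hp.2])
  have hqi := integrable_toReal_of_lintegral_ne_top hq.1 (by rwa [hq.2])
  refine ⟨hae, (hpi.sub hqi).congr heq.symm, ?_⟩
  rw [integral_congr_ae heq, integral_sub hpi hqi,
    integral_toReal hp.1 (ae_lt_top' hp.1 (by rwa [hp.2])),
    integral_toReal hq.1 (ae_lt_top' hq.1 (by rwa [hq.2])), hp.2, hq.2,
    integral_eq_lintegral_pos_part_sub_lintegral_neg_part hint]

namespace IsPoissonProcess

lemma lintegral_factorialMeasure_pi [SigmaFinite M] (hη : IsPoissonProcess η M P) {m : ℕ}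
    {B : Fin m → Set 𝕏} (hB : ∀ i, MeasurableSet (B i)) (hfin : ∀ i, M (B i) ≠ ∞) :
    AEMeasurable (fun ω ↦ factorialMeasure (η ω) m (Set.univ.pi B)) P ∧
      ∫⁻ ω, factorialMeasure (η ω) m (Set.univ.pi B) ∂P
        = Measure.pi (fun _ ↦ M) (Set.univ.pi B) := by
  classical
  have h (c : Fin m → AtomIndex m) := hη.lintegral_factorialMeasure_pi_disjoint
    (A := fun b : AtomIndex m ↦ boolAtom B b.1) (fun b ↦ measurableSet_boolAtom hB _)
    (fun b b' hb ↦ boolAtom_disjoint B (Subtype.coe_injective.ne hb))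
    (fun b ↦ by
      obtain ⟨i, hi⟩ := b.2
      refine ne_top_of_le_ne_top (hfin i) (measure_mono ((Set.iInter_subset _ i).trans ?_))
      simp [hi]) m c
  have hm (c : Fin m → AtomIndex m) : AEMeasurable (fun ω ↦ if (∀ i, (c i).1 i = true)
      then factorialMeasure (η ω) m (Set.univ.pi fun i ↦ boolAtom B (c i).1) else 0) P := by
    split_ifs
    exacts [(h c).1, aemeasurable_const]
  simp_rw [measure_pi_eq_sum_boolAtom hB]
  refine ⟨Finset.aemeasurable_fun_sum _ fun c _ ↦ hm c, ?_⟩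
  rw [lintegral_finsetSum' _ fun c _ ↦ hm c]
  refine Finset.sum_congr rfl fun c _ ↦ ?_
  split_ifs
  · rw [(h c).2, Measure.pi_pi]
  · simp

/-- The mean of the factorial measure on a cube of finite mass, by Dynkin's `π`-`λ` theorem. -/
lemma lintegral_factorialMeasure_inter_box [SigmaFinite M] (hη : IsPoissonProcess η M P) {m : ℕ}
    {K : Set 𝕏} (hK : MeasurableSet K) (hfin : M K ≠ ∞) {C : Set (Fin m → 𝕏)}
    (hC : MeasurableSet C) :
    AEMeasurable (fun ω ↦ factorialMeasure (η ω) m (C ∩ Set.univ.pi fun _ ↦ K)) P ∧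
      ∫⁻ ω, factorialMeasure (η ω) m (C ∩ Set.univ.pi fun _ ↦ K) ∂P
        = Measure.pi (fun _ ↦ M) (C ∩ Set.univ.pi fun _ ↦ K) := by
  set Q : Set (Fin m → 𝕏) := Set.univ.pi fun _ ↦ K with hQ
  have hQm : MeasurableSet Q := MeasurableSet.univ_pi fun _ ↦ hK
  have hQM : Measure.pi (fun _ ↦ M) Q ≠ ∞ := by
    rw [hQ, Measure.pi_pi]
    exact ENNReal.prod_ne_top fun _ _ ↦ hfin
  have hbox := hη.lintegral_factorialMeasure_pi (m := m) (fun _ ↦ hK) (fun _ ↦ hfin)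
  refine MeasurableSpace.induction_on_inter (C := fun C _ ↦
    AEMeasurable (fun ω ↦ factorialMeasure (η ω) m (C ∩ Q)) P ∧
      ∫⁻ ω, factorialMeasure (η ω) m (C ∩ Q) ∂P = Measure.pi (fun _ ↦ M) (C ∩ Q))
    generateFrom_pi.symm isPiSystem_pi ?_ ?_ ?_ ?_ C hC
  · simp
  · rintro _ ⟨B, hB, rfl⟩
    rw [hQ, ← Set.pi_inter_distrib]
    exact hη.lintegral_factorialMeasure_pi (fun i ↦ (hB i (Set.mem_univ _)).inter hK)
      fun i ↦ ne_top_of_le_ne_top hfin (measure_mono Set.inter_subset_right)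
  · intro C hC ih
    have hae : (fun ω ↦ factorialMeasure (η ω) m (Cᶜ ∩ Q)) =ᵐ[P]
        fun ω ↦ factorialMeasure (η ω) m Q - factorialMeasure (η ω) m (C ∩ Q) := by
      filter_upwards [ae_lt_top' hbox.1 (by rwa [hbox.2])] with ω hω
      rw [← measure_sdiff Set.inter_subset_right (hC.inter hQm).nullMeasurableSet
        (ne_top_of_le_ne_top hω.ne (measure_mono Set.inter_subset_right))]
      congr 1
      ext x
      simp only [Set.mem_inter_iff, Set.mem_compl_iff, Set.mem_sdiff]
      tauto
    refine ⟨(hbox.1.sub ih.1).congr hae.symm, ?_⟩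
    rw [lintegral_congr_ae hae, lintegral_sub' ih.1 ?_ ?_, hbox.2, ih.2,
      ← measure_sdiff Set.inter_subset_right (hC.inter hQm).nullMeasurableSet
        (ne_top_of_le_ne_top hQM (measure_mono Set.inter_subset_right))]
    · congr 1
      ext x
      simp only [Set.mem_inter_iff, Set.mem_compl_iff, Set.mem_sdiff]
      tauto
    · rw [ih.2]
      exact ne_top_of_le_ne_top hQM (measure_mono Set.inter_subset_right)
    · exact ae_of_all _ fun ω ↦ measure_mono Set.inter_subset_right
  · intro C hdisj hC ih
    have h (μ : Measure (Fin m → 𝕏)) : μ ((⋃ i, C i) ∩ Q) = ∑' i, μ (C i ∩ Q) := by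
      rw [Set.iUnion_inter, measure_iUnion _ fun i ↦ (hC i).inter hQm]
      exact fun i j hij ↦ (hdisj hij).mono Set.inter_subset_left Set.inter_subset_left
    simp_rw [h]
    refine ⟨AEMeasurable.tsum fun i ↦ (ih i).1, ?_⟩
    rw [lintegral_tsum fun i ↦ (ih i).1]
    exact tsum_congr fun i ↦ (ih i).2

/-- The multivariate Mecke formula for deterministic integrands: the mean measure of the `m`-th
factorial measure of a Poisson process is the `m`-th power of its intensity measure. -/
theorem lintegral_factorialMeasure [SigmaFinite M] (hη : IsPoissonProcess η M P) {m : ℕ}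
    {F : (Fin m → 𝕏) → ℝ≥0∞} (hF : Measurable F) :
    AEMeasurable (fun ω ↦ ∫⁻ x, F x ∂(factorialMeasure (η ω) m)) P ∧
      ∫⁻ ω, ∫⁻ x, F x ∂(factorialMeasure (η ω) m) ∂P = ∫⁻ x, F x ∂(Measure.pi fun _ ↦ M) := by
  have hset {C : Set (Fin m → 𝕏)} (hC : MeasurableSet C) :
      AEMeasurable (fun ω ↦ factorialMeasure (η ω) m C) P ∧
      ∫⁻ ω, factorialMeasure (η ω) m C ∂P = Measure.pi (fun _ ↦ M) C := by
    have hmono : Monotone fun n ↦ C ∩ Set.univ.pi fun _ : Fin m ↦ spanningSets M n :=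
      fun i j hij ↦ Set.inter_subset_inter_right C
        (Set.pi_mono fun _ _ ↦ monotone_spanningSets M hij)
    have h1 (μ : Measure (Fin m → 𝕏)) :
        μ C = ⨆ n, μ (C ∩ Set.univ.pi fun _ : Fin m ↦ spanningSets M n) := by
      rw [← Directed.measure_iUnion hmono.directed_le, ← Set.inter_iUnion,
        Set.iUnion_univ_pi_of_monotone fun _ ↦ monotone_spanningSets M]
      simp [iUnion_spanningSets]
    have h2 (n : ℕ) := hη.lintegral_factorialMeasure_inter_box (measurableSet_spanningSets M n)
      (measure_spanningSets_lt_top M n).ne hC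
    rw [funext fun ω ↦ h1 (factorialMeasure (η ω) m), h1 (Measure.pi fun _ ↦ M)]
    refine ⟨AEMeasurable.iSup fun n ↦ (h2 n).1, ?_⟩
    rw [lintegral_iSup' (fun n ↦ (h2 n).1)
      (ae_of_all _ fun ω i j hij ↦ measure_mono (hmono hij))]
    exact iSup_congr fun n ↦ (h2 n).2
  refine Measurable.ennreal_induction (motive := fun F ↦
    AEMeasurable (fun ω ↦ ∫⁻ x, F x ∂(factorialMeasure (η ω) m)) P ∧
      ∫⁻ ω, ∫⁻ x, F x ∂(factorialMeasure (η ω) m) ∂P = ∫⁻ x, F x ∂(Measure.pi fun _ ↦ M))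
    ?_ ?_ ?_ hF
  · intro c C hC
    simp_rw [lintegral_indicator_const hC]
    refine ⟨(hset hC).1.const_mul c, ?_⟩
    rw [lintegral_const_mul'' _ (hset hC).1, (hset hC).2]
  · intro F G _ hF hG ihF ihG
    simp only [Pi.add_apply]
    simp_rw [lintegral_add_left hF]
    refine ⟨ihF.1.add ihG.1, ?_⟩
    rw [lintegral_add_left' ihF.1, ihF.2, ihG.2]
  · intro F hF hmono ih
    simp_rw [lintegral_iSup hF hmono]
    refine ⟨AEMeasurable.iSup fun n ↦ (ih n).1, ?_⟩
    rw [lintegral_iSup' (fun n ↦ (ih n).1)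
      (ae_of_all _ fun ω i j hij ↦ lintegral_mono (hmono hij))]
    exact iSup_congr fun n ↦ (ih n).2

variable {S : Type*} [Fintype S]

lemma lintegral_factorialMeasureOn [SigmaFinite M] (hη : IsPoissonProcess η M P)
    {F : (S → 𝕏) → ℝ≥0∞} (hF : Measurable F) :
    AEMeasurable (fun ω ↦ ∫⁻ x, F x ∂(factorialMeasureOn (η ω) S)) P ∧
      ∫⁻ ω, ∫⁻ x, F x ∂(factorialMeasureOn (η ω) S) ∂P = ∫⁻ x, F x ∂(Measure.pi fun _ ↦ M) := by
  have hmeas : Measurable fun (y : Fin (Fintype.card S) → 𝕏) (s : S) ↦ y (Fintype.equivFin S s) :=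
    by fun_prop
  have h := hη.lintegral_factorialMeasure (hF.comp hmeas)
  simp_rw [factorialMeasureOn, lintegral_map hF hmeas]
  refine ⟨h.1, h.2.trans ?_⟩
  exact (measurePreserving_comp_equiv (fun _ ↦ M) (Fintype.equivFin S)).lintegral_comp hF

/-- The Mecke formula for real integrands. -/
lemma integral_factorialMeasureOn [SigmaFinite M] (hη : IsPoissonProcess η M P)
    {F : (S → 𝕏) → ℝ} (hF : Measurable F) (hint : Integrable F (Measure.pi fun _ ↦ M)) :
    (∀ᵐ ω ∂P, Integrable F (factorialMeasureOn (η ω) S)) ∧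
      Integrable (fun ω ↦ ∫ x, F x ∂(factorialMeasureOn (η ω) S)) P ∧
      ∫ ω, ∫ x, F x ∂(factorialMeasureOn (η ω) S) ∂P = ∫ x, F x ∂(Measure.pi fun _ ↦ M) :=
  integral_randomMeasure (fun _ hF ↦ hη.lintegral_factorialMeasureOn hF) hF hint

lemma integral_factorialMeasure [SigmaFinite M] (hη : IsPoissonProcess η M P) {m : ℕ}
    {F : (Fin m → 𝕏) → ℝ} (hF : Measurable F) (hint : Integrable F (Measure.pi fun _ ↦ M)) :
    (∀ᵐ ω ∂P, Integrable F (factorialMeasure (η ω) m)) ∧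
      Integrable (fun ω ↦ ∫ x, F x ∂(factorialMeasure (η ω) m)) P ∧
      ∫ ω, ∫ x, F x ∂(factorialMeasure (η ω) m) ∂P = ∫ x, F x ∂(Measure.pi fun _ ↦ M) :=
  integral_randomMeasure (fun _ hF ↦ hη.lintegral_factorialMeasure hF) hF hint

end IsPoissonProcess

end Mecke

/-! ### Second moments of Poisson U-statistics -/

section SecondMoment

variable {𝕏 : Type*} [MeasurableSpace 𝕏]

lemma sFinite_factorialMeasure {μ : Measure 𝕏} [SigmaFinite μ] (hμ : IsIntegerValued μ) (m : ℕ) :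
    SFinite (factorialMeasure μ m) := by
  obtain ⟨ι, _, ν, h1, h2, h⟩ := hμ.exists_sum
  have : Countable (Fin m ↪ ι) := DFunLike.coe_injective.countable
  rw [factorialMeasure_eq_distinctTuples ν h, distinctTuples]
  infer_instance

variable {m n : ℕ}

/-- The function `(f ⊗ h)_φ` of the blocks of a non-flat partition `φ` of two rows. -/
def pairing (f : (Fin m → 𝕏) → ℝ) (h : (Fin n → 𝕏) → ℝ) (φ : Fin n → Option (Fin m))
    (y : Glue φ → 𝕏) : ℝ :=
  f (unglue φ y).1 * h (unglue φ y).2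

lemma measurable_pairing {f : (Fin m → 𝕏) → ℝ} {h : (Fin n → 𝕏) → ℝ} (hf : Measurable f)
    (hh : Measurable h) (φ : Fin n → Option (Fin m)) : Measurable (pairing f h φ) :=
  (hf.comp (measurable_unglue φ).fst).mul (hh.comp (measurable_unglue φ).snd)

/-- Integrability of `(f ⊗ h)_φ` for all non-flat partitions `φ` of the two rows. -/
def PairIntegrable (M : Measure 𝕏) (f : (Fin m → 𝕏) → ℝ) (h : (Fin n → 𝕏) → ℝ) : Prop :=
  ∀ φ : Fin n → Option (Fin m), IsMatching φ →
    Integrable (pairing f h φ) (Measure.pi fun _ ↦ M)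

variable {Ω : Type*} [MeasurableSpace Ω] {P : Measure Ω} {η : Ω → Measure 𝕏} {M : Measure 𝕏}

/-- The mixed second moment of two U-statistics is the sum over all non-flat partitions of the two
rows. -/
lemma IsPoissonProcess.integral_mul [SigmaFinite M] (hη : IsPoissonProcess η M P)
    {f : (Fin m → 𝕏) → ℝ} {h : (Fin n → 𝕏) → ℝ} (hf : Measurable f) (hh : Measurable h)
    (hfh : PairIntegrable M f h) :
    Integrable (fun ω ↦ (∫ x, f x ∂(factorialMeasure (η ω) m))
        * ∫ x, h x ∂(factorialMeasure (η ω) n)) P ∧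
      ∫ ω, (∫ x, f x ∂(factorialMeasure (η ω) m)) * (∫ x, h x ∂(factorialMeasure (η ω) n)) ∂P
        = ∑ φ : {φ : Fin n → Option (Fin m) // IsMatching φ},
          ∫ y, pairing f h φ.1 y ∂(Measure.pi fun _ ↦ M) := by
  have key (φ : {φ : Fin n → Option (Fin m) // IsMatching φ}) :=
    hη.integral_factorialMeasureOn (measurable_pairing hf hh φ.1) (hfh φ.1 φ.2)
  have hae : (fun ω ↦ (∫ x, f x ∂(factorialMeasure (η ω) m))
        * ∫ x, h x ∂(factorialMeasure (η ω) n)) =ᵐ[P]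
      fun ω ↦ ∑ φ : {φ : Fin n → Option (Fin m) // IsMatching φ},
          ∫ y, pairing f h φ.1 y ∂(factorialMeasureOn (η ω) (Glue φ.1)) := by
    filter_upwards [ae_all_iff.2 fun φ ↦ (key φ).1] with ω hω
    have := hη.sigmaFinite ω
    have := sFinite_factorialMeasure (hη.integerValued ω) m
    have := sFinite_factorialMeasure (hη.integerValued ω) n
    have hm : Measurable fun p : (Fin m → 𝕏) × (Fin n → 𝕏) ↦ f p.1 * h p.2 := by fun_prop
    rw [← integral_prod_mul, factorialMeasure_prod (hη.integerValued ω),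
      integral_finsetSum_measure fun φ _ ↦ ?_]
    · refine Finset.sum_congr rfl fun φ _ ↦ ?_
      rw [integral_map (measurable_unglue _).aemeasurable hm.aestronglyMeasurable]
      rfl
    · rw [integrable_map_measure hm.aestronglyMeasurable (measurable_unglue _).aemeasurable]
      exact hω φ
  refine ⟨(integrable_finsetSum _ fun φ _ ↦ (key φ).2.1).congr hae.symm, ?_⟩
  rw [integral_congr_ae hae, integral_finsetSum _ fun φ _ ↦ (key φ).2.1]
  exact Finset.sum_congr rfl fun φ _ ↦ (key φ).2.2

lemma pi_smul_measure {S : Type*} [Fintype S] (Λ : Measure 𝕏) [SigmaFinite Λ] (c : ℝ≥0∞)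
    [SigmaFinite (c • Λ)] :
    (Measure.pi fun _ : S ↦ c • Λ) = c ^ Fintype.card S • Measure.pi fun _ : S ↦ Λ := by
  refine Measure.pi_eq fun B _ ↦ ?_
  rw [Measure.smul_apply, Measure.pi_pi, smul_eq_mul]
  simp [Finset.prod_mul_distrib]

lemma sigmaFinite_ofReal_smul (Λ : Measure 𝕏) [SigmaFinite Λ] (t : ℝ) :
    SigmaFinite (ENNReal.ofReal t • Λ) :=
  inferInstanceAs (SigmaFinite (t.toNNReal • Λ))

lemma integral_pi_smul {S : Type*} [Fintype S] (Λ : Measure 𝕏) [SigmaFinite Λ] {t : ℝ}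
    (ht : 0 ≤ t) (F : (S → 𝕏) → ℝ) :
    ∫ y, F y ∂(Measure.pi fun _ ↦ ENNReal.ofReal t • Λ)
      = t ^ Fintype.card S * ∫ y, F y ∂(Measure.pi fun _ ↦ Λ) := by
  have := sigmaFinite_ofReal_smul Λ t
  rw [pi_smul_measure, integral_smul_measure, ENNReal.toReal_pow, ENNReal.toReal_ofReal ht,
    smul_eq_mul]

lemma integrable_pi_smul {S : Type*} [Fintype S] (Λ : Measure 𝕏) [SigmaFinite Λ] (t : ℝ)
    {F : (S → 𝕏) → ℝ} (hF : Integrable F (Measure.pi fun _ ↦ Λ)) :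
    Integrable F (Measure.pi fun _ ↦ ENNReal.ofReal t • Λ) := by
  have := sigmaFinite_ofReal_smul Λ t
  rw [pi_smul_measure]
  exact hF.smul_measure (by simp)

variable {Λ : Measure 𝕏} [SigmaFinite Λ]

lemma PairIntegrable.smul {f : (Fin m → 𝕏) → ℝ} {h : (Fin n → 𝕏) → ℝ}
    (hfh : PairIntegrable Λ f h) (t : ℝ) : PairIntegrable (ENNReal.ofReal t • Λ) f h :=
  fun φ hφ ↦ integrable_pi_smul Λ t (hfh φ hφ)

/-- The partition without matched pairs. -/
def noMatch (m n : ℕ) : {φ : Fin n → Option (Fin m) // IsMatching φ} :=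
  ⟨fun _ ↦ none, fun _ _ _ h ↦ by simp at h⟩

lemma measurePreserving_unglue_noMatch (M : Measure 𝕏) [SigmaFinite M] (m n : ℕ) :
    MeasurePreserving (unglue (𝕏 := 𝕏) (noMatch m n).1) (Measure.pi fun _ ↦ M)
      ((Measure.pi fun _ ↦ M).prod (Measure.pi fun _ ↦ M)) := by
  let e : Fin n ≃ {b : Fin n // (noMatch m n).1 b = none} :=
    (Equiv.subtypeUnivEquiv fun _ ↦ rfl).symm
  have h1 := (measurePreserving_sumPiEquivProdPi
    (X := fun _ : Glue (noMatch m n).1 ↦ 𝕏) fun _ ↦ M)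
  exact ((MeasurePreserving.id (Measure.pi fun _ : Fin m ↦ M)).prod
    (measurePreserving_comp_equiv (fun _ ↦ M) e)).comp h1

lemma integral_pairing_noMatch (M : Measure 𝕏) [SigmaFinite M] (f : (Fin m → 𝕏) → ℝ)
    (h : (Fin n → 𝕏) → ℝ) (hf : Measurable f) (hh : Measurable h) :
    ∫ y, pairing f h (noMatch m n).1 y ∂(Measure.pi fun _ ↦ M)
      = (∫ x, f x ∂(Measure.pi fun _ ↦ M)) * ∫ x, h x ∂(Measure.pi fun _ ↦ M) := by
  have h2 := measurePreserving_unglue_noMatch M m n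
  rw [← integral_prod_mul, ← h2.map_eq, integral_map h2.measurable.aemeasurable (by fun_prop)]
  rfl

lemma integrable_pairing_noMatch {f : (Fin m → 𝕏) → ℝ} {h : (Fin n → 𝕏) → ℝ}
    (hf : Integrable f (Measure.pi fun _ ↦ Λ)) (hh : Integrable h (Measure.pi fun _ ↦ Λ)) :
    Integrable (pairing f h (noMatch m n).1) (Measure.pi fun _ ↦ Λ) := by
  have h2 := hf.mul_prod hh
  exact ((measurePreserving_unglue_noMatch Λ m n).integrable_comp h2.1).2 h2

/-- The covariance of two U-statistics. -/
lemma IsPoissonProcess.covariance_eq [IsProbabilityMeasure P] {t : ℝ} (ht : 0 ≤ t)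
    (hη : IsPoissonProcess η (ENNReal.ofReal t • Λ) P)
    {f : (Fin m → 𝕏) → ℝ} {h : (Fin n → 𝕏) → ℝ} (hf : Measurable f) (hh : Measurable h)
    (hfi : Integrable f (Measure.pi fun _ ↦ Λ)) (hhi : Integrable h (Measure.pi fun _ ↦ Λ))
    (hfh : PairIntegrable Λ f h) :
    (∫ ω, (∫ x, f x ∂(factorialMeasure (η ω) m)) * (∫ x, h x ∂(factorialMeasure (η ω) n)) ∂P)
        - (∫ ω, ∫ x, f x ∂(factorialMeasure (η ω) m) ∂P)
          * ∫ ω, ∫ x, h x ∂(factorialMeasure (η ω) n) ∂P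
      = ∑ φ ∈ Finset.univ.erase (noMatch m n), t ^ Fintype.card (Glue φ.1)
          * ∫ y, pairing f h φ.1 y ∂(Measure.pi fun _ ↦ Λ) := by
  have := sigmaFinite_ofReal_smul Λ t
  rw [(hη.integral_mul hf hh (hfh.smul t)).2,
    (hη.integral_factorialMeasure hf (integrable_pi_smul Λ t hfi)).2.2,
    (hη.integral_factorialMeasure hh (integrable_pi_smul Λ t hhi)).2.2,
    ← integral_pairing_noMatch _ _ _ hf hh,
    ← Finset.add_sum_erase _ _ (Finset.mem_univ (noMatch m n)), add_sub_cancel_left]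
  exact Finset.sum_congr rfl fun φ _ ↦ integral_pi_smul Λ ht _

lemma IsPoissonProcess.memLp_two {t : ℝ}
    (hη : IsPoissonProcess η (ENNReal.ofReal t • Λ) P)
    {f : (Fin m → 𝕏) → ℝ} (hf : Measurable f) (hfi : Integrable f (Measure.pi fun _ ↦ Λ))
    (hff : PairIntegrable Λ f f) :
    MemLp (fun ω ↦ ∫ x, f x ∂(factorialMeasure (η ω) m)) 2 P := by
  have := sigmaFinite_ofReal_smul Λ t
  rw [memLp_two_iff_integrable_sq
    (hη.integral_factorialMeasure hf (integrable_pi_smul Λ t hfi)).2.1.1]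
  simpa only [sq] using (hη.integral_mul hf hf (hff.smul t)).1

end SecondMoment

/-! ### The leading term of the covariance -/

section Leading

variable {m n : ℕ}

/-- The partition with exactly one matched pair `(a, b)`. -/
def singleMatch (a : Fin m) (b : Fin n) : {φ : Fin n → Option (Fin m) // IsMatching φ} :=
  ⟨fun b' ↦ if b' = b then some a else none, fun b₁ b₂ a' h₁ h₂ ↦ by
    simp only [ite_eq_iff, reduceCtorEq, and_false, or_false] at h₁ h₂
    rw [h₁.1, h₂.1]⟩

lemma singleMatch_injective :
    Function.Injective fun p : Fin m × Fin n ↦ singleMatch p.1 p.2 := by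
  rintro ⟨a, b⟩ ⟨a', b'⟩ h
  have h1 := congrFun (congrArg Subtype.val h) b
  simp only [singleMatch, if_true] at h1
  split_ifs at h1 with hb
  simp only [Option.some.injEq] at h1
  rw [h1, hb]

/-- The number of unmatched elements of the second row. -/
def unmatched (φ : Fin n → Option (Fin m)) : ℕ := Fintype.card {b : Fin n // φ b = none}

lemma card_glue (φ : Fin n → Option (Fin m)) : Fintype.card (Glue φ) = m + unmatched φ := by
  rw [Fintype.card_sum, Fintype.card_fin, unmatched]

lemma unmatched_add (φ : Fin n → Option (Fin m)) :
    unmatched φ + (Finset.univ.filter fun b ↦ φ b ≠ none).card = n := by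
  have : unmatched φ = (Finset.univ.filter fun b ↦ φ b = none).card := by
    rw [unmatched]
    convert! Fintype.card_subtype fun b ↦ φ b = none
  rw [this, Finset.card_filter_add_card_filter_not, Finset.card_univ, Fintype.card_fin]

lemma unmatched_lt_of_ne {φ : {φ : Fin n → Option (Fin m) // IsMatching φ}}
    (h : φ ≠ noMatch m n) : unmatched φ.1 < n := by
  have h1 := unmatched_add φ.1
  have h2 : (Finset.univ.filter fun b ↦ φ.1 b ≠ none).Nonempty := by
    by_contra hne
    rw [Finset.not_nonempty_iff_eq_empty, Finset.filter_eq_empty_iff] at hne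
    refine h (Subtype.ext (funext fun b ↦ ?_))
    simpa [noMatch] using hne (Finset.mem_univ b)
  have := h2.card_pos
  omega

lemma unmatched_add_one_eq_iff {φ : {φ : Fin n → Option (Fin m) // IsMatching φ}} :
    unmatched φ.1 + 1 = n ↔ ∃ p : Fin m × Fin n, singleMatch p.1 p.2 = φ := by
  have h1 := unmatched_add φ.1
  constructor
  · intro h
    obtain ⟨b, hb⟩ := Finset.card_eq_one.1
      (show (Finset.univ.filter fun b ↦ φ.1 b ≠ none).card = 1 by omega)
    have hb1 : φ.1 b ≠ none := by
      have : b ∈ (Finset.univ.filter fun b ↦ φ.1 b ≠ none) := by rw [hb]; simp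
      simpa using this
    obtain ⟨a, ha⟩ := Option.ne_none_iff_exists'.1 hb1
    refine ⟨(a, b), Subtype.ext (funext fun b' ↦ ?_)⟩
    simp only [singleMatch]
    by_cases hbb : b' = b
    · rw [if_pos hbb, hbb, ha]
    · rw [if_neg hbb]
      by_contra hne
      have : b' ∈ (Finset.univ.filter fun b ↦ φ.1 b ≠ none) := by
        simpa using fun h ↦ hne h.symm
      rw [hb] at this
      exact hbb (by simpa using this)
  · rintro ⟨⟨a, b⟩, rfl⟩
    have : (Finset.univ.filter fun b' ↦ (singleMatch a b).1 b' ≠ none) = {b} := by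
      ext b'
      simp [singleMatch]
    rw [this] at h1
    simpa using h1

variable {𝕏 : Type*} [MeasurableSpace 𝕏] {Λ : Measure 𝕏} [SigmaFinite Λ]

/-- Only the partitions with a single matched pair contribute to the limit of the normalized
covariance. -/
lemma tendsto_covariance_sum (I : {φ : Fin n → Option (Fin m) // IsMatching φ} → ℝ) :
    Tendsto (fun t : ℝ ↦ t ^ (-((m : ℝ) - 1 / 2)) * t ^ (-((n : ℝ) - 1 / 2))
        * ∑ φ ∈ Finset.univ.erase (noMatch m n), t ^ Fintype.card (Glue φ.1) * I φ)
      atTop (𝓝 (∑ p : Fin m × Fin n, I (singleMatch p.1 p.2))) := by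
  classical
  have hlim : (∑ p : Fin m × Fin n, I (singleMatch p.1 p.2))
      = ∑ φ ∈ Finset.univ.erase (noMatch m n), if unmatched φ.1 + 1 = n then I φ else 0 := by
    rw [← Finset.sum_filter]
    refine Finset.sum_bij (fun p _ ↦ singleMatch p.1 p.2) ?_ ?_ ?_ fun _ _ ↦ rfl
    · rintro ⟨a, b⟩ -
      rw [Finset.mem_filter, Finset.mem_erase]
      refine ⟨⟨fun h ↦ ?_, Finset.mem_univ _⟩, unmatched_add_one_eq_iff.2 ⟨(a, b), rfl⟩⟩
      have := congrFun (congrArg Subtype.val h) b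
      simp [singleMatch, noMatch] at this
    · exact fun p _ q _ h ↦ singleMatch_injective h
    · intro φ hφ
      obtain ⟨p, hp⟩ := unmatched_add_one_eq_iff.1 (Finset.mem_filter.1 hφ).2
      exact ⟨p, Finset.mem_univ _, hp⟩
  rw [hlim]
  have heq : (fun t : ℝ ↦ ∑ φ ∈ Finset.univ.erase (noMatch m n),
      t ^ ((unmatched φ.1 : ℝ) + 1 - n) * I φ) =ᶠ[atTop]
      fun t : ℝ ↦ t ^ (-((m : ℝ) - 1 / 2)) * t ^ (-((n : ℝ) - 1 / 2))
        * ∑ φ ∈ Finset.univ.erase (noMatch m n), t ^ Fintype.card (Glue φ.1) * I φ := by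
    filter_upwards [eventually_gt_atTop 0] with t ht
    rw [Finset.mul_sum]
    refine Finset.sum_congr rfl fun φ _ ↦ ?_
    -- the normalized term of `φ` has exponent `unmatched φ + 1 - n ≤ 0`
    rw [← mul_assoc, card_glue, ← Real.rpow_natCast, ← Real.rpow_add ht, ← Real.rpow_add ht]
    congr 2
    push_cast
    ring
  refine Tendsto.congr' heq (tendsto_finsetSum _ fun φ hφ ↦ ?_)
  have hlt := unmatched_lt_of_ne (Finset.ne_of_mem_erase hφ)
  split_ifs with h
  · have : (unmatched φ.1 : ℝ) + 1 - n = 0 := by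
      rw [sub_eq_zero]
      exact_mod_cast h
    simp [this]
  · have hpos : 0 < (n : ℝ) - (unmatched φ.1 + 1) := by
      rw [sub_pos]
      exact_mod_cast (show unmatched φ.1 + 1 < n by omega)
    have := (tendsto_rpow_neg_atTop hpos).mul_const (I φ)
    rw [zero_mul] at this
    refine this.congr fun t ↦ ?_
    congr 2
    ring

/-- The integral of `f` over all but its first argument. -/
def marginal (Λ : Measure 𝕏) (f : (Fin (m + 1) → 𝕏) → ℝ) (x : 𝕏) : ℝ :=
  ∫ y : Fin m → 𝕏, f (Fin.cons x y) ∂(Measure.pi fun _ ↦ Λ)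

lemma kernelFn_one (Λ : Measure 𝕏) (f : (Fin (m + 1) → 𝕏) → ℝ) (x : 𝕏) :
    kernelFn Λ f 1 (fun _ ↦ x) = ((m + 1 : ℕ) : ℝ) * marginal Λ f x := by
  rw [kernelFn, Nat.choose_one_right, marginal]
  congr 1
  refine integral_congr_ae (ae_of_all _ fun y ↦ ?_)
  simp only
  congr 1
  ext a
  refine Fin.cases ?_ (fun i ↦ ?_) a
  · simp
  · simp only [Fin.val_succ, Fin.cons_succ]
    rw [dif_neg (by omega)]
    rfl

lemma measurable_cons :
    Measurable fun p : 𝕏 × (Fin m → 𝕏) ↦ (Fin.cons p.1 p.2 : Fin (m + 1) → 𝕏) := by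
  refine measurable_pi_lambda _ fun i ↦ ?_
  refine Fin.cases ?_ (fun j ↦ ?_) i
  · simpa using measurable_fst
  · simp only [Fin.cons_succ]
    exact (measurable_pi_apply j).comp measurable_snd

lemma measurable_marginal {f : (Fin (m + 1) → 𝕏) → ℝ} (hf : Measurable f) :
    Measurable (marginal Λ f) :=
  (StronglyMeasurable.integral_prod_right
    (f := fun x (y : Fin m → 𝕏) ↦ f (Fin.cons x y))
    (hf.comp measurable_cons).stronglyMeasurable).measurable

/-- The elements of the second row left unmatched by `singleMatch a b` are those other than `b`. -/
def singleMatchSplit (a : Fin (m + 1)) (b : Fin (n + 1)) :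
    Fin n ≃ {b' : Fin (n + 1) // (singleMatch a b).1 b' = none} :=
  (finSuccAboveEquiv b).trans (Equiv.subtypeEquivRight fun b' ↦ by simp [singleMatch])

/-- The coordinates on the blocks of `singleMatch a b` split into the one of the common block and
those of the other elements of the first and of the second row. -/
lemma exists_measurePreserving_singleMatch (Λ : Measure 𝕏) [SigmaFinite Λ] (a : Fin (m + 1))
    (b : Fin (n + 1)) :
    ∃ Ψ : 𝕏 × (Fin m → 𝕏) × (Fin n → 𝕏) → (Glue (singleMatch a b).1 → 𝕏),
      MeasurePreserving Ψ
        (Λ.prod ((Measure.pi fun _ ↦ Λ).prod (Measure.pi fun _ ↦ Λ))) (Measure.pi fun _ ↦ Λ) ∧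
      ∀ p, unglue (singleMatch a b).1 (Ψ p) = (a.insertNth p.1 p.2.1, b.insertNth p.1 p.2.2) := by
  have h1 := (measurePreserving_prodAssoc Λ (Measure.pi fun _ : Fin m ↦ Λ)
    (Measure.pi fun _ : Fin n ↦ Λ)).symm
  have h2 := (measurePreserving_piFinSuccAbove (fun _ : Fin (m + 1) ↦ Λ) a).symm.prod
    (measurePreserving_comp_equiv (fun _ ↦ Λ) (singleMatchSplit a b).symm)
  have h3 := measurePreserving_sumPiEquivProdPi_symm
    (X := fun _ : Glue (singleMatch a b).1 ↦ 𝕏) fun _ ↦ Λ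
  refine ⟨_, h3.comp (h2.comp h1), fun p ↦ ?_⟩
  refine Prod.ext rfl ?_
  ext b'
  refine Fin.succAboveCases b ?_ (fun j ↦ ?_) b'
  · have : glue (singleMatch a b).1 b = Sum.inl a := glue_of_some (by simp [singleMatch])
    simp only [unglue, this, Fin.insertNth_apply_same]
    change (a.insertNth p.1 p.2.1 : Fin (m + 1) → 𝕏) a = _
    simp
  · have h : (singleMatch a b).1 (b.succAbove j) = none := by simp [singleMatch]
    simp only [unglue, glue_of_none h, Fin.insertNth_apply_succAbove]
    change p.2.2 ((singleMatchSplit a b).symm ⟨b.succAbove j, h⟩) = _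
    exact congrArg _ ((singleMatchSplit a b).symm_apply_eq.2 rfl)

/-- For symmetric kernels the term of a single matched pair is an integral of marginals, by
Fubini's theorem. -/
lemma integral_pairing_singleMatch {f : (Fin (m + 1) → 𝕏) → ℝ} {h : (Fin (n + 1) → 𝕏) → ℝ}
    (hf : Measurable f) (hh : Measurable h)
    (hfs : ∀ (e : Equiv.Perm (Fin (m + 1))) (x : Fin (m + 1) → 𝕏), f (x ∘ e) = f x)
    (hhs : ∀ (e : Equiv.Perm (Fin (n + 1))) (x : Fin (n + 1) → 𝕏), h (x ∘ e) = h x)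
    (hfh : PairIntegrable Λ f h) (a : Fin (m + 1)) (b : Fin (n + 1)) :
    Integrable (fun x ↦ marginal Λ f x * marginal Λ h x) Λ ∧
      ∫ y, pairing f h (singleMatch a b).1 y ∂(Measure.pi fun _ ↦ Λ)
        = ∫ x, marginal Λ f x * marginal Λ h x ∂Λ := by
  obtain ⟨Ψ, hΨ, hu⟩ := exists_measurePreserving_singleMatch Λ a b
  have hpair (p : 𝕏 × (Fin m → 𝕏) × (Fin n → 𝕏)) :
      pairing f h (singleMatch a b).1 (Ψ p) = f (Fin.cons p.1 p.2.1) * h (Fin.cons p.1 p.2.2) := by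
    -- by symmetry of the kernels the matched argument may be moved to the first position
    rw [pairing, hu, ← Fin.cons_comp_cycleRange, ← Fin.cons_comp_cycleRange, hfs, hhs]
  have hm := measurable_pairing hf hh (singleMatch a b).1
  have hint : Integrable (fun p : 𝕏 × (Fin m → 𝕏) × (Fin n → 𝕏) ↦
      f (Fin.cons p.1 p.2.1) * h (Fin.cons p.1 p.2.2))
      (Λ.prod ((Measure.pi fun _ ↦ Λ).prod (Measure.pi fun _ ↦ Λ))) := by
    have := (hΨ.integrable_comp hm.aestronglyMeasurable).2 (hfh _ (singleMatch a b).2)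
    exact this.congr (ae_of_all _ hpair)
  have hinner (x : 𝕏) : ∫ q : (Fin m → 𝕏) × (Fin n → 𝕏), f (Fin.cons x q.1) * h (Fin.cons x q.2)
      ∂((Measure.pi fun _ ↦ Λ).prod (Measure.pi fun _ ↦ Λ)) = marginal Λ f x * marginal Λ h x :=
    integral_prod_mul (fun y : Fin m → 𝕏 ↦ f (Fin.cons x y)) fun z : Fin n → 𝕏 ↦ h (Fin.cons x z)
  constructor
  · exact hint.integral_prod_left.congr (ae_of_all _ hinner)
  · rw [← hΨ.map_eq, integral_map hΨ.measurable.aemeasurable hm.aestronglyMeasurable,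
      integral_congr_ae (ae_of_all _ hpair), integral_prod _ hint]
    exact integral_congr_ae (ae_of_all _ hinner)

/-- The sum of the terms of all single matched pairs. -/
lemma sum_integral_pairing_singleMatch (hm : 1 ≤ m) (hn : 1 ≤ n) {f : (Fin m → 𝕏) → ℝ}
    {h : (Fin n → 𝕏) → ℝ} (hf : IsL1Sym Λ f) (hh : IsL1Sym Λ h) (hfh : PairIntegrable Λ f h) :
    Integrable (fun x ↦ kernelFn Λ f 1 (fun _ ↦ x) * kernelFn Λ h 1 (fun _ ↦ x)) Λ ∧
    ∑ p : Fin m × Fin n, ∫ y, pairing f h (singleMatch p.1 p.2).1 y ∂(Measure.pi fun _ ↦ Λ)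
      = ∫ x, kernelFn Λ f 1 (fun _ ↦ x) * kernelFn Λ h 1 (fun _ ↦ x) ∂Λ := by
  obtain ⟨m, rfl⟩ := Nat.exists_eq_add_of_le' hm
  obtain ⟨n, rfl⟩ := Nat.exists_eq_add_of_le' hn
  have key := integral_pairing_singleMatch hf.measurable hh.measurable hf.symm hh.symm hfh
  have e (x : 𝕏) : kernelFn Λ f 1 (fun _ ↦ x) * kernelFn Λ h 1 (fun _ ↦ x)
      = (((m + 1) * (n + 1) : ℕ) : ℝ) * (marginal Λ f x * marginal Λ h x) := by
    rw [kernelFn_one, kernelFn_one]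
    push_cast
    ring
  simp_rw [e, fun p : Fin (m + 1) × Fin (n + 1) ↦ (key p.1 p.2).2]
  refine ⟨(key 0 0).1.const_mul _, ?_⟩
  rw [integral_const_mul]
  simp

lemma measurable_kernelFn_one (hm : 1 ≤ m) {f : (Fin m → 𝕏) → ℝ} (hf : Measurable f) :
    Measurable fun x ↦ kernelFn Λ f 1 fun _ ↦ x := by
  obtain ⟨m, rfl⟩ := Nat.exists_eq_add_of_le' hm
  simp_rw [kernelFn_one]
  exact (measurable_marginal hf).const_mul _

end Leading

/-! ### Non-flat partitions of two rows as partial matchings -/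

section Conversion

variable {𝕏 : Type*} [MeasurableSpace 𝕏] {Λ : Measure 𝕏} [SigmaFinite Λ]

/-- The partition of `D` into the fibres of `q`. -/
def fibrePartition {D S : Type*} [Fintype D] [DecidableEq D] [DecidableEq S] (q : D → S) :
    Finpartition (Finset.univ : Finset D) :=
  @Finpartition.ofSetoid D _ _ (Setoid.ker q) fun a b ↦ decEq (q a) (q b)

section

variable {D S : Type*} [Fintype D] [DecidableEq D] [DecidableEq S] (q : D → S)

lemma mem_part_fibrePartition {p p' : D} : p' ∈ (fibrePartition q).part p ↔ q p = q p' :=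
  Finpartition.mem_part_ofSetoid_iff_rel

lemma part_fibrePartition_eq_iff {p p' : D} :
    (fibrePartition q).part p = (fibrePartition q).part p' ↔ q p = q p' := by
  constructor
  · intro h
    have : p' ∈ (fibrePartition q).part p' := (mem_part_fibrePartition q).2 rfl
    rw [← h] at this
    exact (mem_part_fibrePartition q).1 this
  · intro h
    ext x
    rw [mem_part_fibrePartition, mem_part_fibrePartition, h]

lemma exists_equiv_fibrePartition (hq : Function.Surjective q) :
    ∃ e : S ≃ (fibrePartition q).parts, ∀ p, (e (q p)).1 = (fibrePartition q).part p := by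
  let G : S → (fibrePartition q).parts := fun s ↦ ⟨(fibrePartition q).part (Function.surjInv hq s),
    (fibrePartition q).part_mem.2 (Finset.mem_univ _)⟩
  have hG (p : D) : (G (q p)).1 = (fibrePartition q).part p :=
    (part_fibrePartition_eq_iff q).2 (Function.surjInv_eq hq _)
  refine ⟨Equiv.ofBijective G ⟨fun s s' h ↦ ?_, fun J ↦ ?_⟩, hG⟩
  · have := (part_fibrePartition_eq_iff q).1 (congrArg Subtype.val h)
    rwa [Function.surjInv_eq hq, Function.surjInv_eq hq] at this
  · obtain ⟨p, hp⟩ := (fibrePartition q).nonempty_of_mem_parts J.2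
    refine ⟨q p, Subtype.ext ?_⟩
    rw [hG, (fibrePartition q).part_eq_of_mem J.2 hp]

end

lemma lintegral_identify_fibrePartition {k : ℕ} {n : Fin k → ℕ} {S : Type*} [Fintype S]
    [DecidableEq S] {q : Diagram n → S} (hq : Function.Surjective q) {F : (Diagram n → 𝕏) → ℝ}
    (hF : Measurable F) :
    ∫⁻ y, ENNReal.ofReal (identify F (fibrePartition q) y) ∂(Measure.pi fun _ ↦ Λ)
      = ∫⁻ z : S → 𝕏, ENNReal.ofReal (F fun p ↦ z (q p)) ∂(Measure.pi fun _ ↦ Λ) := by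
  obtain ⟨e, he⟩ := exists_equiv_fibrePartition q hq
  have hm : Measurable fun z : S → 𝕏 ↦ ENNReal.ofReal (F fun p ↦ z (q p)) := by fun_prop
  rw [← (measurePreserving_comp_equiv (fun _ ↦ Λ) e).lintegral_comp hm]
  refine lintegral_congr fun y ↦ ?_
  rw [identify]
  congr 3
  ext p
  congr 1
  exact Subtype.ext (he p).symm

/-- The map sending an element of two rows to its block. -/
def rowsToGlue {n : Fin 2 → ℕ} (φ : Fin (n 1) → Option (Fin (n 0))) : Diagram n → Glue φ
  | ⟨0, a⟩ => Sum.inl a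
  | ⟨1, b⟩ => glue φ b

/-- Finiteness of the integrals over all non-flat partitions of two rows gives integrability for
all partial matchings. -/
lemma pairIntegrable_of_lintegral_lt_top {n : Fin 2 → ℕ} {f : (j : Fin 2) → (Fin (n j) → 𝕏) → ℝ}
    (hf : ∀ j, Measurable (f j))
    (h : ∀ σ : Finpartition (Finset.univ : Finset (Diagram n)), IsNonFlat σ →
      ∫⁻ y, ENNReal.ofReal (identify (tensor fun j x ↦ |f j x|) σ y) ∂(Measure.pi fun _ ↦ Λ) < ∞) :
    PairIntegrable Λ (f 0) (f 1) := by
  intro φ hφ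
  have hq : Function.Surjective (rowsToGlue φ) := by
    rintro (a | ⟨b, hb⟩)
    · exact ⟨⟨0, a⟩, rfl⟩
    · exact ⟨⟨1, b⟩, glue_of_none hb⟩
  have hinj : ∀ p p' : Diagram n, p.1 = p'.1 → rowsToGlue φ p = rowsToGlue φ p' → p = p' := by
    rintro ⟨j, a⟩ ⟨j', a'⟩ hj h
    simp only at hj
    subst hj
    fin_cases j
    · simpa [rowsToGlue] using h
    · simpa [rowsToGlue] using hφ.glue_injective h
  have hnf : IsNonFlat (fibrePartition (rowsToGlue φ)) := by
    intro j J hJ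
    refine Finset.card_le_one.2 fun p hp p' hp' ↦ ?_
    simp only [row, Finset.mem_inter, Finset.mem_filter, Finset.mem_univ, true_and] at hp hp'
    refine hinj p p' (hp.1.trans hp'.1.symm) ?_
    rw [← mem_part_fibrePartition, Finpartition.part_eq_of_mem _ hJ hp.2]
    exact hp'.2
  have hfm : Measurable (tensor fun j x ↦ |f j x| : (Diagram n → 𝕏) → ℝ) := by
    unfold tensor
    refine Finset.measurable_fun_prod _ fun j _ ↦ ?_
    have := hf j
    fun_prop
  refine ⟨(measurable_pairing (hf 0) (hf 1) φ).aestronglyMeasurable, ?_⟩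
  have := h _ hnf
  rw [lintegral_identify_fibrePartition hq hfm] at this
  refine lt_of_eq_of_lt (lintegral_congr fun y ↦ ?_) this
  rw [← ofReal_norm, Real.norm_eq_abs, pairing, abs_mul, tensor, Fin.prod_univ_two]
  rfl

end Conversion

/-! ### Limits of covariances -/

section CovarianceLimit

variable {𝕏 : Type*} [MeasurableSpace 𝕏] {Λ : Measure 𝕏} [SigmaFinite Λ]
variable {Ω : Type*} [MeasurableSpace Ω] {P : Measure Ω} [IsProbabilityMeasure P] {m n : ℕ}

lemma IsPoissonProcess.memLp_normalizedUStat {t : ℝ} {η : Ω → Measure 𝕏}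
    (hη : IsPoissonProcess η (ENNReal.ofReal t • Λ) P)
    {f : (Fin m → 𝕏) → ℝ} (hf : IsL1Sym Λ f) (hff : PairIntegrable Λ f f) (s c : ℝ) :
    MemLp (normalizedUStat P s c f η) 2 P := by
  have h := hη.memLp_two hf.measurable hf.integrable hff
  exact ((h.const_mul c).sub (memLp_const _)).const_mul _

lemma IsPoissonProcess.integral_normalizedUStat {t : ℝ} {η : Ω → Measure 𝕏}
    (hη : IsPoissonProcess η (ENNReal.ofReal t • Λ) P)
    {f : (Fin m → 𝕏) → ℝ} (hf : IsL1Sym Λ f) (hff : PairIntegrable Λ f f) (s c : ℝ) :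
    ∫ ω, normalizedUStat P s c f η ω ∂P = 0 := by
  have h := (hη.memLp_two hf.measurable hf.integrable hff).integrable one_le_two
  have h' : Integrable (uStat c f η) P := h.const_mul c
  simp only [normalizedUStat]
  rw [integral_const_mul, integral_sub h' (integrable_const _)]
  simp

lemma IsPoissonProcess.covariance_normalizedUStat {t : ℝ} (ht : 0 < t) {η : Ω → Measure 𝕏}
    (hη : IsPoissonProcess η (ENNReal.ofReal t • Λ) P)
    {f : (Fin m → 𝕏) → ℝ} {h : (Fin n → 𝕏) → ℝ} (hf : IsL1Sym Λ f) (hh : IsL1Sym Λ h)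
    (hff : PairIntegrable Λ f f) (hhh : PairIntegrable Λ h h) (hfh : PairIntegrable Λ f h)
    {c d : ℝ} (hc : c ≠ 0) (hd : d ≠ 0) :
    cov[normalizedUStat P t c f η, normalizedUStat P t d h η; P]
      = t ^ (-((m : ℝ) - 1 / 2)) * t ^ (-((n : ℝ) - 1 / 2))
        * ∑ φ ∈ Finset.univ.erase (noMatch m n), t ^ Fintype.card (Glue φ.1)
          * ∫ y, pairing f h φ.1 y ∂(Measure.pi fun _ ↦ Λ) := by
  have h1 := hη.memLp_two hf.measurable hf.integrable hff
  have h2 := hη.memLp_two hh.measurable hh.integrable hhh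
  have e {k : ℕ} (u : (Fin k → 𝕏) → ℝ) {c : ℝ} (hc : c ≠ 0) : normalizedUStat P t c u η
      = fun ω ↦ t ^ (-((k : ℝ) - 1 / 2)) * ((∫ x, u x ∂(factorialMeasure (η ω) k))
        - ∫ ω', ∫ x, u x ∂(factorialMeasure (η ω') k) ∂P) := by
    ext ω
    simp only [normalizedUStat, uStat]
    rw [integral_const_mul]
    field_simp
  rw [e f hc, e h hd, covariance_const_mul_left, covariance_const_mul_right,
    covariance_sub_const_left (h1.integrable one_le_two),
    covariance_sub_const_right (h2.integrable one_le_two), covariance_eq_sub h1 h2, ← mul_assoc]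
  simp only [Pi.mul_apply]
  rw [hη.covariance_eq ht.le hf.measurable hh.measurable hf.integrable hh.integrable hfh]

/-- The limit of the covariance of two normalized U-statistics. -/
lemma tendsto_covariance_normalizedUStat (hm : 1 ≤ m) (hn : 1 ≤ n)
    {η : Set.Ioi (0 : ℝ) → Ω → Measure 𝕏}
    (hη : ∀ t, IsPoissonProcess (η t) (ENNReal.ofReal (t : ℝ) • Λ) P)
    {f : (Fin m → 𝕏) → ℝ} {h : (Fin n → 𝕏) → ℝ} (hf : IsL1Sym Λ f) (hh : IsL1Sym Λ h)
    (hff : PairIntegrable Λ f f) (hhh : PairIntegrable Λ h h) (hfh : PairIntegrable Λ f h)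
    {c d : Set.Ioi (0 : ℝ) → ℝ} (hc : ∀ᶠ t in atTop, c t ≠ 0) (hd : ∀ᶠ t in atTop, d t ≠ 0) :
    Tendsto (fun t : Set.Ioi (0 : ℝ) ↦
        cov[normalizedUStat P t (c t) f (η t), normalizedUStat P t (d t) h (η t); P])
      atTop (𝓝 (∫ x, kernelFn Λ f 1 (fun _ ↦ x) * kernelFn Λ h 1 (fun _ ↦ x) ∂Λ)) := by
  have hlim := tendsto_covariance_sum (m := m) (n := n) fun φ ↦
    ∫ y, pairing f h φ.1 y ∂(Measure.pi fun _ ↦ Λ)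
  rw [(sum_integral_pairing_singleMatch hm hn hf hh hfh).2,
    ← tendsto_comp_val_Ioi_atTop (a := 0)] at hlim
  refine hlim.congr' ?_
  filter_upwards [hc, hd] with t hct hdt
  rw [(hη t).covariance_normalizedUStat t.2 hf hh hff hhh hfh hct hdt]

end CovarianceLimit

/-! ### Linear statistics of simple functions -/

section Linear

variable {𝕏 : Type*} [MeasurableSpace 𝕏] {Λ : Measure 𝕏} {m : ℕ}

/-- A function on `𝕏` as a kernel of order one. -/
def kernelOfFun (w : 𝕏 → ℝ) (x : Fin 1 → 𝕏) : ℝ := w (x 0)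

lemma isL1Sym_kernelOfFun {w : 𝕏 → ℝ} (hw : Measurable w) (hwi : Integrable w Λ) :
    IsL1Sym Λ (kernelOfFun w) where
  measurable := by unfold kernelOfFun; fun_prop
  symm e x := by rw [Subsingleton.elim e 1]; rfl
  integrable := by
    have := (measurePreserving_funUnique Λ (Fin 1)).integrable_comp_emb
      (MeasurableEquiv.measurableEmbedding _) (g := w)
    exact this.2 hwi

lemma kernelFn_kernelOfFun (w : 𝕏 → ℝ) (x : 𝕏) :
    kernelFn Λ (kernelOfFun w) 1 (fun _ ↦ x) = w x := by
  rw [kernelFn_one, marginal]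
  simp [kernelOfFun, measureReal_def, Measure.pi_empty_univ]

variable [SigmaFinite Λ]

/-- Pairing with a bounded integrable kernel of order one requires no further integrability. -/
lemma pairIntegrable_kernelOfFun {f : (Fin m → 𝕏) → ℝ} (hf : Measurable f)
    (hfi : Integrable f (Measure.pi fun _ ↦ Λ)) {w : 𝕏 → ℝ} (hw : Measurable w)
    (hwi : Integrable w Λ) {C : ℝ} (hC : ∀ x, |w x| ≤ C) :
    PairIntegrable Λ f (kernelOfFun w) := by
  have hW := isL1Sym_kernelOfFun hw hwi
  intro φ hφ
  cases h0 : φ 0 with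
  | none =>
    obtain rfl : φ = (noMatch m 1).1 := by
      ext1 b
      rw [Subsingleton.elim b 0, h0]
      rfl
    exact integrable_pairing_noMatch hfi hW.integrable
  | some a =>
    have : IsEmpty {b : Fin 1 // φ b = none} := ⟨fun b ↦ by
      have := b.2
      rw [Subsingleton.elim b.1 0, h0] at this
      simp at this⟩
    have h1 := measurePreserving_comp_equiv (fun _ : Glue φ ↦ Λ) (Equiv.sumEmpty (Fin m) _).symm
    have h2 := (h1.integrable_comp hf.aestronglyMeasurable).2 hfi
    refine h2.mul_bdd (c := C) ?_ (ae_of_all _ fun y ↦ hC _)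
    exact (hW.measurable.comp (measurable_unglue φ).snd).aestronglyMeasurable

/-- Integration against the first factorial measure. -/
lemma integral_kernelOfFun {μ : Measure 𝕏} [SigmaFinite μ] (hμ : IsIntegerValued μ) {w : 𝕏 → ℝ}
    (hw : Measurable w) : ∫ x, kernelOfFun w x ∂(factorialMeasure μ 1) = ∫ x, w x ∂μ := by
  have h := map_snoc_factorialMeasure_prod hμ 0
  simp only [Finset.univ_eq_empty, Finset.sum_empty, add_zero] at h
  have hW : Measurable (kernelOfFun w) := by unfold kernelOfFun; fun_prop
  have hm : Measurable (Prod.mk (Fin.elim0 : Fin 0 → 𝕏) : 𝕏 → _) := measurable_prodMk_left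
  rw [← h, integral_map measurable_snoc.aemeasurable hW.aestronglyMeasurable, factorialMeasure,
    Measure.dirac_prod]
  exact integral_map hm.aemeasurable (hW.comp measurable_snoc).aestronglyMeasurable

end Linear

/-! ### The central limit theorem for linear statistics of simple functions -/

section LinearCLT

variable {𝕏 : Type*} [MeasurableSpace 𝕏]
variable {Ω : Type*} [MeasurableSpace Ω] {P : Measure Ω} {η : Ω → Measure 𝕏} {M : Measure 𝕏}

/-- The nonzero values of a simple function. -/
def nonzeroRange (w : SimpleFunc 𝕏 ℝ) : Finset ℝ := w.range.filter (· ≠ 0)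

lemma ne_zero_of_mem_nonzeroRange {w : SimpleFunc 𝕏 ℝ} (x : nonzeroRange w) : (x : ℝ) ≠ 0 :=
  (Finset.mem_filter.1 x.2).2

/-- The integral of a function of a simple function, as a sum over the nonzero values. The set where
the simple function vanishes may have infinite mass. -/
lemma integral_simpleFunc {μ : Measure 𝕏} {w : SimpleFunc 𝕏 ℝ}
    (hw : ∀ x : nonzeroRange w, μ (w ⁻¹' {(x : ℝ)}) ≠ ∞) {g : ℝ → ℝ} (hg : g 0 = 0) :
    ∫ x, g (w x) ∂μ = ∑ x : nonzeroRange w, (μ (w ⁻¹' {(x : ℝ)})).toReal * g x := by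
  have hi : Integrable w μ := by
    rw [SimpleFunc.integrable_iff]
    intro y hy
    by_cases hr : y ∈ w.range
    · exact (hw ⟨y, Finset.mem_filter.2 ⟨hr, hy⟩⟩).lt_top
    · rw [(SimpleFunc.preimage_eq_empty_iff w y).2 hr]
      simp
  have h2 : Integrable (w.map g) μ := by
    rw [SimpleFunc.integrable_iff_finMeasSupp] at hi ⊢
    exact hi.map hg
  have h1 := SimpleFunc.map_integral w g hi hg
  rw [SimpleFunc.integral_eq_integral _ h2] at h1
  simp only [SimpleFunc.map_apply] at h1
  rw [h1, Finset.univ_eq_attach, nonzeroRange,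
    Finset.sum_attach (w.range.filter (· ≠ 0)) fun x ↦ (μ (w ⁻¹' {x})).toReal * g x,
    Finset.sum_filter]
  refine Finset.sum_congr rfl fun x _ ↦ ?_
  split_ifs with hx
  · rfl
  · rw [not_not.1 hx, hg, smul_zero]

/-- The characteristic function of the number of points in a set. -/
lemma IsPoissonProcess.integral_cexp_apply (hη : IsPoissonProcess η M P) {B : Set 𝕏}
    (hB : MeasurableSet B) (hfin : M B ≠ ∞) (u : ℝ) :
    ∫ ω, Complex.exp ((u * (η ω B).toReal : ℝ) * Complex.I) ∂P
      = Complex.exp ((M B).toReal * (Complex.exp (u * Complex.I) - 1)) := by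
  have hm : Measurable fun x : ℝ≥0∞ ↦ Complex.exp ((u * x.toReal : ℝ) * Complex.I) := by fun_prop
  have h1 := integral_map (μ := P) (hη.measurable_apply hB).aemeasurable
    (hm.aestronglyMeasurable (μ := P.map fun ω ↦ η ω B))
  rw [← h1, hη.law B hB hfin, integral_map (by fun_prop) hm.aestronglyMeasurable]
  have h2 := charFun_map_cast_poissonMeasure (M B).toNNReal u
  rw [charFun_apply_real, integral_map (by fun_prop) (by fun_prop)] at h2
  rw [show ((M B).toReal : ℂ) = (((M B).toNNReal : ℝ) : ℂ) from rfl]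
  rw [← h2]
  refine integral_congr_ae (ae_of_all _ fun n ↦ ?_)
  simp

/-- The characteristic function of a linear statistic of a simple function. -/
lemma IsPoissonProcess.integral_cexp_simpleFunc (hη : IsPoissonProcess η M P)
    {w : SimpleFunc 𝕏 ℝ} (hw : ∀ x : nonzeroRange w, M (w ⁻¹' {(x : ℝ)}) ≠ ∞) (s : ℝ) :
    ∫ ω, Complex.exp ((s * ∫ x, w x ∂(η ω) : ℝ) * Complex.I) ∂P
      = Complex.exp (∑ x : nonzeroRange w, (M (w ⁻¹' {(x : ℝ)})).toReal
        * (Complex.exp ((s * x : ℝ) * Complex.I) - 1)) := by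
  have hA (x : nonzeroRange w) : MeasurableSet (w ⁻¹' {(x : ℝ)}) := w.measurableSet_preimage _
  have hdisj : Pairwise (Function.onFun Disjoint fun x : nonzeroRange w ↦ w ⁻¹' {(x : ℝ)}) :=
    fun x y hxy ↦ Disjoint.preimage _ (by simpa using fun h ↦ hxy (Subtype.ext h))
  have hae : (fun ω ↦ Complex.exp ((s * ∫ x, w x ∂(η ω) : ℝ) * Complex.I)) =ᵐ[P]
      fun ω ↦ ∏ x : nonzeroRange w,
        Complex.exp (((s * x) * (η ω (w ⁻¹' {(x : ℝ)})).toReal : ℝ) * Complex.I) := by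
    filter_upwards [ae_all_iff.2 fun x ↦ hη.ae_apply_ne_top (hA x) (hw x)] with ω hω
    have h1 := integral_simpleFunc (g := id) hω rfl
    simp only [id] at h1
    rw [← Complex.exp_sum, h1, ← Finset.sum_mul,
      ← Complex.ofReal_sum, Finset.mul_sum]
    congr 4
    ext x
    ring
  rw [integral_congr_ae hae]
  have hm (x : nonzeroRange w) : Measurable fun y : ℝ≥0∞ ↦
      Complex.exp (((s * x) * y.toReal : ℝ) * Complex.I) := by fun_prop
  rw [(hη.iIndepFun_apply hA hdisj).integral_fun_prod_comp
    (f := fun (x : nonzeroRange w) y ↦ Complex.exp (((s * x) * y.toReal : ℝ) * Complex.I))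
    (fun x ↦ (hη.measurable_apply (hA x)).aemeasurable) fun x ↦ (hm x).aestronglyMeasurable,
    Complex.exp_sum]
  exact Finset.prod_congr rfl fun x _ ↦ hη.integral_cexp_apply (hA x) (hw x) _

/-- Second-order expansion of the exponent of a compensated Poisson variable. -/
lemma tendsto_mul_cexp_sub (x : ℝ) :
    Tendsto (fun t : ℝ ↦ (t : ℂ) * (Complex.exp ((t ^ (-(1 / 2) : ℝ) * x : ℝ) * Complex.I) - 1
        - (t ^ (-(1 / 2) : ℝ) * x : ℝ) * Complex.I)) atTop (𝓝 (-(x ^ 2 / 2 : ℝ) : ℂ)) := by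
  have hs : Tendsto (fun t : ℝ ↦ t ^ (-(1 / 2) : ℝ)) atTop (𝓝 0) :=
    tendsto_rpow_neg_atTop (by norm_num)
  rw [tendsto_iff_norm_sub_tendsto_zero]
  have hb : Tendsto (fun t : ℝ ↦ |x| ^ 3 * t ^ (-(1 / 2) : ℝ)) atTop (𝓝 0) := by
    simpa using hs.const_mul (|x| ^ 3)
  have hsmall : ∀ᶠ t : ℝ in atTop, |t ^ (-(1 / 2) : ℝ) * x| ≤ 1 := by
    have : Tendsto (fun t : ℝ ↦ |t ^ (-(1 / 2) : ℝ) * x|) atTop (𝓝 0) := by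
      simpa using (hs.mul_const x).abs
    exact (this.eventually (gt_mem_nhds one_pos)).mono fun t ht ↦ le_of_lt ht
  refine squeeze_zero' (Eventually.of_forall fun t ↦ norm_nonneg _) ?_ hb
  filter_upwards [hsmall, eventually_gt_atTop 0] with t ht htpos
  set s : ℝ := t ^ (-(1 / 2) : ℝ) with hsdef
  have hspos : 0 < s := Real.rpow_pos_of_pos htpos _
  have hts : t * s ^ 2 = 1 := by
    rw [hsdef, ← Real.rpow_natCast, ← Real.rpow_mul htpos.le]
    norm_num
    rw [Real.rpow_neg_one, mul_inv_cancel₀ htpos.ne']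
  set z : ℂ := (s * x : ℝ) * Complex.I with hz
  have hzn : ‖z‖ = |s * x| := by rw [hz, norm_mul, Complex.norm_I, mul_one, Complex.norm_real,
    Real.norm_eq_abs]
  have hexp := Complex.exp_bound (x := z) (by rwa [hzn]) (n := 3) (by norm_num)
  have hz2 : z ^ 2 = -((s * x) ^ 2 : ℝ) := by
    rw [hz, mul_pow, Complex.I_sq]
    push_cast
    ring
  have heq : (t : ℂ) * (Complex.exp z - 1 - z) - -(x ^ 2 / 2 : ℝ)
      = t * (Complex.exp z - ∑ m ∈ Finset.range 3, z ^ m / (m.factorial : ℂ)) := by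
    simp only [Finset.sum_range_succ, Finset.sum_range_zero]
    have h2 : (t : ℂ) * z ^ 2 = -(x ^ 2 : ℝ) := by
      rw [hz2, mul_neg, ← Complex.ofReal_mul]
      congr 2
      linear_combination x ^ 2 * hts
    have h3 : (t : ℂ) * (z ^ 2 / 2) = -(x ^ 2 / 2 : ℝ) := by
      rw [← mul_div_assoc, h2]
      push_cast
      ring
    simp only [Nat.factorial]
    push_cast at h3 ⊢
    linear_combination h3
  rw [heq, norm_mul, Complex.norm_real, Real.norm_eq_abs, abs_of_pos htpos]
  calc t * ‖Complex.exp z - ∑ m ∈ Finset.range 3, z ^ m / (m.factorial : ℂ)‖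
      ≤ t * (‖z‖ ^ 3 * 1) := by
        refine mul_le_mul_of_nonneg_left (hexp.trans ?_) htpos.le
        refine mul_le_mul_of_nonneg_left ?_ (by positivity)
        norm_num [Nat.factorial]
    _ = |x| ^ 3 * s := by
        rw [hzn, abs_mul, abs_of_pos hspos]
        linear_combination (|x| ^ 3 * s) * hts

variable {Λ : Measure 𝕏} [SigmaFinite Λ]

/-- The central limit theorem for linear statistics of simple functions, in terms of
characteristic functions. -/
lemma tendsto_integral_cexp_simpleFunc {η : Set.Ioi (0 : ℝ) → Ω → Measure 𝕏}
    (hη : ∀ t, IsPoissonProcess (η t) (ENNReal.ofReal (t : ℝ) • Λ) P)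
    {w : SimpleFunc 𝕏 ℝ} (hw : ∀ x : nonzeroRange w, Λ (w ⁻¹' {(x : ℝ)}) ≠ ∞)
    (hwi : Integrable w Λ) :
    Tendsto (fun t : Set.Ioi (0 : ℝ) ↦
        ∫ ω, Complex.exp (normalizedUStat P t 1 (kernelOfFun w) (η t) ω * Complex.I) ∂P)
      atTop (𝓝 (Complex.exp (-((∫ x, w x ^ 2 ∂Λ) / 2 : ℝ)))) := by
  have hlim : Tendsto (fun t : ℝ ↦ Complex.exp (∑ x : nonzeroRange w,
      ((Λ (w ⁻¹' {(x : ℝ)})).toReal : ℂ) * ((t : ℂ) *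
        (Complex.exp ((t ^ (-(1 / 2) : ℝ) * x : ℝ) * Complex.I) - 1
        - (t ^ (-(1 / 2) : ℝ) * x : ℝ) * Complex.I)))) atTop
      (𝓝 (Complex.exp (∑ x : nonzeroRange w,
        ((Λ (w ⁻¹' {(x : ℝ)})).toReal : ℂ) * (-((x : ℝ) ^ 2 / 2 : ℝ) : ℂ)))) :=
    (Complex.continuous_exp.tendsto _).comp
      (tendsto_finsetSum _ fun x _ ↦ (tendsto_mul_cexp_sub x).const_mul _)
  have hval : (∑ x : nonzeroRange w, ((Λ (w ⁻¹' {(x : ℝ)})).toReal : ℂ)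
      * (-((x : ℝ) ^ 2 / 2 : ℝ) : ℂ)) = (-((∫ x, w x ^ 2 ∂Λ) / 2 : ℝ) : ℂ) := by
    rw [integral_simpleFunc (g := fun y ↦ y ^ 2) hw (by norm_num), Finset.sum_div]
    push_cast
    rw [← Finset.sum_neg_distrib]
    refine Finset.sum_congr rfl fun x _ ↦ ?_
    ring
  rw [hval, ← tendsto_comp_val_Ioi_atTop (a := 0)] at hlim
  refine hlim.congr fun t ↦ ?_
  have ht : (0 : ℝ) < t := t.2
  have := sigmaFinite_ofReal_smul Λ t
  have hW := isL1Sym_kernelOfFun w.measurable hwi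
  have hmean : ∫ ω, ∫ x, kernelOfFun w x ∂(factorialMeasure (η t ω) 1) ∂P
      = t * ∑ x : nonzeroRange w, (Λ (w ⁻¹' {(x : ℝ)})).toReal * x := by
    rw [((hη t).integral_factorialMeasure hW.measurable
      (integrable_pi_smul Λ t hW.integrable)).2.2, integral_pi_smul Λ ht.le]
    have h1 : ∫ y, kernelOfFun w y ∂(Measure.pi fun _ : Fin 1 ↦ Λ) = ∫ x, w x ∂Λ :=
      (measurePreserving_funUnique Λ (Fin 1)).integral_comp
        (MeasurableEquiv.measurableEmbedding _) w
    have h2 := integral_simpleFunc (g := id) hw rfl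
    simp only [id] at h2
    rw [h1, h2]
    simp
  set s : ℝ := (t : ℝ) ^ (-(1 / 2) : ℝ) with hs
  set b : ℝ := t * ∑ x : nonzeroRange w, (Λ (w ⁻¹' {(x : ℝ)})).toReal * x with hb
  have hL (ω : Ω) : normalizedUStat P t 1 (kernelOfFun w) (η t) ω
      = s * (∫ x, w x ∂(η t ω)) + -(s * b) := by
    have := (hη t).sigmaFinite ω
    simp only [normalizedUStat, uStat, one_mul, inv_one]
    rw [hmean, integral_kernelOfFun ((hη t).integerValued ω) w.measurable,
      show -(((1 : ℕ) : ℝ) - 1 / 2) = -(1 / 2) by norm_num]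
    ring
  have hfin (x : nonzeroRange w) : (ENNReal.ofReal (t : ℝ) • Λ) (w ⁻¹' {(x : ℝ)}) ≠ ∞ := by
    rw [Measure.smul_apply, smul_eq_mul]
    exact ENNReal.mul_ne_top (by simp) (hw x)
  have hexp (ω : Ω) : Complex.exp (normalizedUStat P t 1 (kernelOfFun w) (η t) ω * Complex.I)
      = Complex.exp ((s * ∫ x, w x ∂(η t ω) : ℝ) * Complex.I)
        * Complex.exp (-(s * b : ℝ) * Complex.I) := by
    rw [hL, ← Complex.exp_add]
    congr 1
    push_cast
    ring
  simp_rw [hexp]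
  rw [integral_mul_const, (hη t).integral_cexp_simpleFunc hfin s, ← Complex.exp_add]
  congr 1
  have hscale (x : nonzeroRange w) : ((ENNReal.ofReal (t : ℝ) • Λ) (w ⁻¹' {(x : ℝ)})).toReal
      = t * (Λ (w ⁻¹' {(x : ℝ)})).toReal := by
    rw [Measure.smul_apply, smul_eq_mul, ENNReal.toReal_mul, ENNReal.toReal_ofReal ht.le]
  simp_rw [hscale, hb]
  push_cast
  rw [Finset.mul_sum, Finset.mul_sum, ← Finset.sum_neg_distrib, Finset.sum_mul,
    ← Finset.sum_add_distrib]
  refine Finset.sum_congr rfl fun x _ ↦ ?_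
  ring

end LinearCLT

/-! ### Approximation and convergence of characteristic functions -/

section Final

variable {Ω : Type*} [MeasurableSpace Ω] {P : Measure Ω} [IsProbabilityMeasure P]

/-- Characteristic functions of square integrable variables differ by at most their distance
in `L²`. -/
lemma norm_integral_cexp_sub_le {X Y : Ω → ℝ} (hX : MemLp X 2 P) (hY : MemLp Y 2 P) :
    ‖(∫ ω, Complex.exp (X ω * Complex.I) ∂P) - ∫ ω, Complex.exp (Y ω * Complex.I) ∂P‖
      ≤ √(∫ ω, (X ω - Y ω) ^ 2 ∂P) := by
  have hi {Z : Ω → ℝ} (hZ : MemLp Z 2 P) :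
      Integrable (fun ω ↦ Complex.exp (Z ω * Complex.I)) P := by
    refine Integrable.of_bound (C := 1) ?_ (ae_of_all _ fun ω ↦ ?_)
    · have := hZ.aestronglyMeasurable.aemeasurable
      exact AEMeasurable.aestronglyMeasurable (by fun_prop)
    · rw [Complex.norm_exp_ofReal_mul_I]
  have hD : MemLp (fun ω ↦ |X ω - Y ω|) 2 P := (hX.sub hY).abs
  have hpt (x y : ℝ) : ‖Complex.exp (x * Complex.I) - Complex.exp (y * Complex.I)‖ ≤ |x - y| := by
    have h1 : Complex.exp (x * Complex.I) - Complex.exp (y * Complex.I)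
        = Complex.exp (y * Complex.I) * (Complex.exp (Complex.I * (x - y : ℝ)) - 1) := by
      rw [mul_sub, ← Complex.exp_add, mul_one]
      congr 2
      push_cast
      ring
    rw [h1, norm_mul, Complex.norm_exp_ofReal_mul_I, one_mul]
    exact Real.norm_exp_I_mul_ofReal_sub_one_le
  have h1 : ‖(∫ ω, Complex.exp (X ω * Complex.I) ∂P) - ∫ ω, Complex.exp (Y ω * Complex.I) ∂P‖
      ≤ ∫ ω, |X ω - Y ω| ∂P := by
    rw [← integral_sub (hi hX) (hi hY)]
    exact (norm_integral_le_integral_norm _).trans (integral_mono ((hi hX).sub (hi hY)).norm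
      (hD.integrable one_le_two) fun ω ↦ hpt _ _)
  refine h1.trans (Real.le_sqrt_of_sq_le ?_)
  have h2 := variance_nonneg (fun ω ↦ |X ω - Y ω|) P
  rw [variance_eq_sub hD, sub_nonneg] at h2
  refine h2.trans_eq (integral_congr_ae (ae_of_all _ fun ω ↦ ?_))
  simp

variable {𝕏 : Type*} [MeasurableSpace 𝕏] {Λ : Measure 𝕏}

lemma integral_sq_eq_toReal_eLpNorm {u : 𝕏 → ℝ} (hu : MemLp u 2 Λ) :
    ∫ x, u x ^ 2 ∂Λ = (eLpNorm u 2 Λ).toReal ^ 2 := by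
  rw [hu.eLpNorm_eq_integral_rpow_norm (by norm_num) (by norm_num),
    ENNReal.toReal_ofReal (by positivity), ← Real.rpow_natCast, ← Real.rpow_mul]
  · norm_num
  · exact integral_nonneg fun x ↦ by positivity

/-- Approximation in `L²` by simple functions, with convergence of second moments. -/
lemma exists_simpleFunc_approx {u : 𝕏 → ℝ} (hu : MemLp u 2 Λ) :
    ∃ w : ℕ → SimpleFunc 𝕏 ℝ, (∀ n, MemLp (w n) 2 Λ) ∧
      Tendsto (fun n ↦ ∫ x, (u x - w n x) ^ 2 ∂Λ) atTop (𝓝 0) ∧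
      Tendsto (fun n ↦ ∫ x, w n x ^ 2 ∂Λ) atTop (𝓝 (∫ x, u x ^ 2 ∂Λ)) := by
  have h (n : ℕ) := hu.exists_simpleFunc_eLpNorm_sub_lt (by norm_num)
    (ε := ENNReal.ofReal (1 / ((n : ℝ) + 1))) (by simp; positivity)
  choose w hw hwp using h
  have hd (n : ℕ) : MemLp (fun x ↦ u x - w n x) 2 Λ := hu.sub (hwp n)
  have hlt (n : ℕ) : (eLpNorm (fun x ↦ u x - w n x) 2 Λ).toReal ≤ 1 / ((n : ℝ) + 1) :=
    ENNReal.toReal_le_of_le_ofReal (by positivity) (hw n).le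
  have h0 : Tendsto (fun n ↦ (eLpNorm (fun x ↦ u x - w n x) 2 Λ).toReal) atTop (𝓝 0) :=
    squeeze_zero (fun n ↦ ENNReal.toReal_nonneg) hlt tendsto_one_div_add_atTop_nhds_zero_nat
  refine ⟨w, hwp, ?_, ?_⟩
  · simp_rw [fun n ↦ integral_sq_eq_toReal_eLpNorm (hd n)]
    simpa using h0.pow 2
  · simp_rw [fun n ↦ integral_sq_eq_toReal_eLpNorm (hwp n)]
    rw [integral_sq_eq_toReal_eLpNorm hu]
    refine Tendsto.pow ?_ 2
    rw [tendsto_iff_norm_sub_tendsto_zero]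
    refine squeeze_zero (fun n ↦ norm_nonneg _) (fun n ↦ ?_) h0
    have hadd {a b c : 𝕏 → ℝ} (ha : MemLp a 2 Λ) (hb : MemLp b 2 Λ) (hc : a = b + c)
        (hcm : MemLp c 2 Λ) :
        (eLpNorm a 2 Λ).toReal ≤ (eLpNorm b 2 Λ).toReal + (eLpNorm c 2 Λ).toReal := by
      rw [← ENNReal.toReal_add hb.2.ne hcm.2.ne, hc]
      exact ENNReal.toReal_mono (ENNReal.add_ne_top.2 ⟨hb.2.ne, hcm.2.ne⟩)
        (eLpNorm_add_le hb.1 hcm.1 one_le_two)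
    have e1 := hadd hu (hwp n) (c := fun x ↦ u x - w n x) (by ext; simp) (hd n)
    have e2 := hadd (hwp n) hu (c := -fun x ↦ u x - w n x) (by ext; simp) (hd n).neg
    rw [eLpNorm_neg] at e2
    rw [Real.norm_eq_abs, abs_le]
    constructor <;> linarith

variable [SigmaFinite Λ] {ℓ : ℕ} {m : Fin ℓ → ℕ} {f : (i : Fin ℓ) → (Fin (m i) → 𝕏) → ℝ}
  {η : Set.Ioi (0 : ℝ) → Ω → Measure 𝕏} {g : Fin ℓ → Set.Ioi (0 : ℝ) → ℝ}

/-- The kernel `f₁` is square integrable, since `∫ f₁² dλ` is the sum of the terms with a single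
matched pair. -/
lemma memLp_kernelFn_one {m : ℕ} (hm : 1 ≤ m) {f : (Fin m → 𝕏) → ℝ} (hf : IsL1Sym Λ f)
    (hff : PairIntegrable Λ f f) : MemLp (fun x ↦ kernelFn Λ f 1 fun _ ↦ x) 2 Λ := by
  rw [memLp_two_iff_integrable_sq (measurable_kernelFn_one hm hf.measurable).aestronglyMeasurable]
  simpa only [sq] using (sum_integral_pairing_singleMatch hm hm hf hf hff).1

/-- The linear combination `∑ᵢ vᵢ f₁⁽ⁱ⁾`. -/
def linearKernel (Λ : Measure 𝕏) (f : (i : Fin ℓ) → (Fin (m i) → 𝕏) → ℝ) (v : Fin ℓ → ℝ)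
    (x : 𝕏) : ℝ :=
  ∑ i, v i * kernelFn Λ (f i) 1 fun _ ↦ x

lemma memLp_linearKernel (hm : ∀ i, 1 ≤ m i) (hf : ∀ i, IsL1Sym Λ (f i))
    (hff : ∀ i j, PairIntegrable Λ (f i) (f j)) (v : Fin ℓ → ℝ) :
    MemLp (linearKernel Λ f v) 2 Λ :=
  memLp_finsetSum _ fun i _ ↦ (memLp_kernelFn_one (hm i) (hf i) (hff i i)).const_mul (v i)

lemma integral_linearKernel_sq (hm : ∀ i, 1 ≤ m i) (hf : ∀ i, IsL1Sym Λ (f i))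
    (hff : ∀ i j, PairIntegrable Λ (f i) (f j)) (v : Fin ℓ → ℝ) :
    ∫ x, linearKernel Λ f v x ^ 2 ∂Λ = ∑ i, ∑ j, v i * v j * asympCov Λ f i j := by
  have h (i j : Fin ℓ) := (sum_integral_pairing_singleMatch (hm i) (hm j) (hf i) (hf j)
    (hff i j)).1
  have e (x : 𝕏) : linearKernel Λ f v x ^ 2 = ∑ i, ∑ j, v i * v j
      * (kernelFn Λ (f i) 1 (fun _ ↦ x) * kernelFn Λ (f j) 1 fun _ ↦ x) := by
    rw [sq, linearKernel, Finset.sum_mul_sum]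
    refine Finset.sum_congr rfl fun i _ ↦ Finset.sum_congr rfl fun j _ ↦ ?_
    ring
  simp_rw [e]
  rw [integral_finsetSum _ fun i _ ↦ integrable_finsetSum _ fun j _ ↦ (h i j).const_mul _]
  refine Finset.sum_congr rfl fun i _ ↦ ?_
  rw [integral_finsetSum _ fun j _ ↦ (h i j).const_mul _]
  refine Finset.sum_congr rfl fun j _ ↦ ?_
  rw [integral_const_mul, asympCov]

/-- The distance in `L²(P)` between a linear combination of the U-statistics and the linear
statistic of a simple function converges to the distance of the kernels in `L²(Λ)`. -/
lemma tendsto_integral_sq_sub (hη : ∀ t, IsPoissonProcess (η t) (ENNReal.ofReal (t : ℝ) • Λ) P)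
    (hm : ∀ i, 1 ≤ m i) (hf : ∀ i, IsL1Sym Λ (f i))
    (hff : ∀ i j, PairIntegrable Λ (f i) (f j)) (hg : ∀ i, ∀ᶠ t in atTop, g i t ≠ 0)
    (v : Fin ℓ → ℝ) {w : SimpleFunc 𝕏 ℝ} (hw2 : MemLp w 2 Λ) (hwi : Integrable w Λ) :
    Tendsto (fun t : Set.Ioi (0 : ℝ) ↦
        ∫ ω, (∑ i, v i * normalizedUStat P t (g i t) (f i) (η t) ω
          - normalizedUStat P t 1 (kernelOfFun w) (η t) ω) ^ 2 ∂P)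
      atTop (𝓝 (∫ x, (linearKernel Λ f v x - w x) ^ 2 ∂Λ)) := by
  obtain ⟨C, hC⟩ := w.exists_forall_norm_le
  have hW := isL1Sym_kernelOfFun w.measurable hwi
  have hfW (i : Fin ℓ) : PairIntegrable Λ (f i) (kernelOfFun w) :=
    pairIntegrable_kernelOfFun (hf i).measurable (hf i).integrable w.measurable hwi hC
  have hWW : PairIntegrable Λ (kernelOfFun w) (kernelOfFun w) :=
    pairIntegrable_kernelOfFun hW.measurable hW.integrable w.measurable hwi hC
  have h1 : ∀ᶠ t : Set.Ioi (0 : ℝ) in atTop, (1 : ℝ) ≠ 0 := Eventually.of_forall fun _ ↦ one_ne_zero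
  have hlim := ((tendsto_finsetSum Finset.univ fun i _ ↦ tendsto_finsetSum Finset.univ fun j _ ↦
    (tendsto_covariance_normalizedUStat (hm i) (hm j) hη (hf i) (hf j) (hff i i) (hff j j)
      (hff i j) (hg i) (hg j)).const_mul (v i * v j)).sub
    ((tendsto_finsetSum Finset.univ fun i _ ↦ (tendsto_covariance_normalizedUStat (hm i) le_rfl hη
      (hf i) hW (hff i i) hWW (hfW i) (hg i) h1).const_mul (v i)).const_mul 2)).add
    (tendsto_covariance_normalizedUStat le_rfl le_rfl hη hW hW hWW hWW hWW h1 h1)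
  have hval : ∫ x, (linearKernel Λ f v x - w x) ^ 2 ∂Λ
      = (∑ i, ∑ j, v i * v j * asympCov Λ f i j)
        - 2 * (∑ i, v i * ∫ x, kernelFn Λ (f i) 1 (fun _ ↦ x)
          * kernelFn Λ (kernelOfFun w) 1 (fun _ ↦ x) ∂Λ)
        + ∫ x, kernelFn Λ (kernelOfFun w) 1 (fun _ ↦ x)
          * kernelFn Λ (kernelOfFun w) 1 (fun _ ↦ x) ∂Λ := by
    simp_rw [kernelFn_kernelOfFun]
    have hu := memLp_linearKernel hm hf hff v
    have hk (i : Fin ℓ) : Integrable (fun x ↦ kernelFn Λ (f i) 1 (fun _ ↦ x) * w x) Λ :=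
      (memLp_kernelFn_one (hm i) (hf i) (hff i i)).integrable_mul hw2
    have e1 : ∑ i, v i * ∫ x, kernelFn Λ (f i) 1 (fun _ ↦ x) * w x ∂Λ
        = ∫ x, linearKernel Λ f v x * w x ∂Λ := by
      simp_rw [linearKernel, Finset.sum_mul, mul_assoc]
      rw [integral_finsetSum _ fun i _ ↦ (hk i).const_mul _]
      simp_rw [integral_const_mul]
    have e2 (x : 𝕏) : (linearKernel Λ f v x - w x) ^ 2
        = linearKernel Λ f v x ^ 2 - 2 * (linearKernel Λ f v x * w x) + w x * w x := by ring
    have i1 : Integrable (fun x ↦ linearKernel Λ f v x ^ 2) Λ := hu.integrable_sq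
    have i2 : Integrable (fun x ↦ linearKernel Λ f v x * w x) Λ := hu.integrable_mul hw2
    have i3 : Integrable (fun x ↦ w x * w x) Λ := hw2.integrable_mul hw2
    have i4 : Integrable (fun x ↦ linearKernel Λ f v x ^ 2 - 2 * (linearKernel Λ f v x * w x)) Λ :=
      i1.sub (i2.const_mul 2)
    rw [← integral_linearKernel_sq hm hf hff, e1]
    simp_rw [e2]
    rw [integral_add i4 i3, integral_sub i1 (i2.const_mul 2), integral_const_mul]
  rw [hval]
  refine hlim.congr fun t ↦ ?_
  have hX (i : Fin ℓ) : MemLp (normalizedUStat P t (g i t) (f i) (η t)) 2 P :=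
    (hη t).memLp_normalizedUStat (hf i) (hff i i) _ _
  have hY : MemLp (normalizedUStat P t 1 (kernelOfFun w) (η t)) 2 P :=
    (hη t).memLp_normalizedUStat hW hWW _ _
  have hvX (i : Fin ℓ) : MemLp (fun ω ↦ v i * normalizedUStat P t (g i t) (f i) (η t) ω) 2 P :=
    (hX i).const_mul _
  have hV : MemLp (fun ω ↦ ∑ i, v i * normalizedUStat P t (g i t) (f i) (η t) ω) 2 P :=
    memLp_finsetSum _ fun i _ ↦ hvX i
  have hmean : ∫ ω, (∑ i, v i * normalizedUStat P t (g i t) (f i) (η t) ω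
      - normalizedUStat P t 1 (kernelOfFun w) (η t) ω) ∂P = 0 := by
    rw [integral_sub (hV.integrable one_le_two) (hY.integrable one_le_two),
      integral_finsetSum _ fun i _ ↦ (hvX i).integrable one_le_two,
      (hη t).integral_normalizedUStat hW hWW]
    simp_rw [integral_const_mul, fun i ↦ (hη t).integral_normalizedUStat (hf i) (hff i i)]
    simp
  -- the second moment of the centred difference is a variance, expanded bilinearly
  have hvar := variance_of_integral_eq_zero (hV.sub hY).aestronglyMeasurable.aemeasurable hmean
  have hvar2 := variance_fun_sub hV hY
  rw [← covariance_self hV.aestronglyMeasurable.aemeasurable,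
    ← covariance_self hY.aestronglyMeasurable.aemeasurable,
    covariance_fun_sum_fun_sum hvX hvX, covariance_fun_sum_left hvX hY] at hvar2
  simp_rw [covariance_const_mul_left, covariance_const_mul_right] at hvar2
  refine Eq.trans ?_ (hvar2.symm.trans hvar)
  simp_rw [mul_assoc]

/-- Convergence of the characteristic functions of linear combinations of the normalized
U-statistics. -/
lemma tendsto_integral_cexp (hη : ∀ t, IsPoissonProcess (η t) (ENNReal.ofReal (t : ℝ) • Λ) P)
    (hm : ∀ i, 1 ≤ m i) (hf : ∀ i, IsL1Sym Λ (f i))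
    (hff : ∀ i j, PairIntegrable Λ (f i) (f j)) (hg : ∀ i, ∀ᶠ t in atTop, g i t ≠ 0)
    (v : Fin ℓ → ℝ) :
    Tendsto (fun t : Set.Ioi (0 : ℝ) ↦ ∫ ω, Complex.exp
        ((∑ i, v i * normalizedUStat P t (g i t) (f i) (η t) ω : ℝ) * Complex.I) ∂P)
      atTop (𝓝 (Complex.exp (-((∫ x, linearKernel Λ f v x ^ 2 ∂Λ) / 2 : ℝ)))) := by
  obtain ⟨w, hw2, hw0, hwlim⟩ := exists_simpleFunc_approx (memLp_linearKernel hm hf hff v)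
  have hroot : Tendsto (fun n ↦ √(∫ x, (linearKernel Λ f v x - w n x) ^ 2 ∂Λ)) atTop (𝓝 0) := by
    simpa using hw0.sqrt
  have hgauss : Tendsto (fun n ↦ Complex.exp (-((∫ x, w n x ^ 2 ∂Λ) / 2 : ℝ))) atTop
      (𝓝 (Complex.exp (-((∫ x, linearKernel Λ f v x ^ 2 ∂Λ) / 2 : ℝ)))) := by
    have hc : Continuous fun r : ℝ ↦ Complex.exp (-((r / 2 : ℝ) : ℂ)) := by fun_prop
    exact (hc.tendsto _).comp hwlim
  rw [Metric.tendsto_nhds]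
  intro ε hε
  obtain ⟨n, hn1, hn2⟩ := ((hroot.eventually (gt_mem_nhds (show (0 : ℝ) < ε / 3 by positivity))).and
    ((Metric.tendsto_nhds.1 hgauss) (ε / 3) (by positivity))).exists
  have hfin (x : nonzeroRange (w n)) : Λ (w n ⁻¹' {(x : ℝ)}) ≠ ∞ :=
    (SimpleFunc.measure_preimage_lt_top_of_memLp (by norm_num) (by norm_num) (w n) (hw2 n) x
      (ne_zero_of_mem_nonzeroRange x)).ne
  have hwi : Integrable (w n) Λ := by
    rw [SimpleFunc.integrable_iff]
    exact fun y hy ↦ SimpleFunc.measure_preimage_lt_top_of_memLp (by norm_num) (by norm_num) (w n)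
      (hw2 n) y hy
  have hL := tendsto_integral_cexp_simpleFunc hη hfin hwi
  have hdist := (tendsto_integral_sq_sub hη hm hf hff hg v (hw2 n) hwi).sqrt
  obtain ⟨C, hC⟩ := (w n).exists_forall_norm_le
  have hW := isL1Sym_kernelOfFun (w n).measurable hwi
  have hWW : PairIntegrable Λ (kernelOfFun (w n)) (kernelOfFun (w n)) :=
    pairIntegrable_kernelOfFun hW.measurable hW.integrable (w n).measurable hwi hC
  filter_upwards [hdist.eventually (gt_mem_nhds hn1),
    (Metric.tendsto_nhds.1 hL) (ε / 3) (by positivity)] with t ht1 ht2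
  have hV : MemLp (fun ω ↦ ∑ i, v i * normalizedUStat P t (g i t) (f i) (η t) ω) 2 P :=
    memLp_finsetSum _ fun i _ ↦
      ((hη t).memLp_normalizedUStat (hf i) (hff i i) _ _).const_mul _
  have hY : MemLp (normalizedUStat P t 1 (kernelOfFun (w n)) (η t)) 2 P :=
    (hη t).memLp_normalizedUStat hW hWW _ _
  have ht3 := norm_integral_cexp_sub_le hV hY
  rw [← dist_eq_norm] at ht3
  calc _ ≤ _ := dist_triangle4 _ _ _ _
    _ < ε / 3 + ε / 3 + ε / 3 := add_lt_add (add_lt_add (ht3.trans_lt ht1) ht2) hn2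
    _ = ε := by ring

end Final

end PoissonU

end

theorem mainTheorem4
    {𝕏 : Type*} [MeasurableSpace 𝕏] (Λ : Measure 𝕏) [SigmaFinite Λ]
    {Ω : Type*} [MeasurableSpace Ω] (P : Measure Ω) [IsProbabilityMeasure P]
    -- `η t` is a Poisson process with intensity measure `t Λ`, for every `t > 0`
    (η : Set.Ioi (0 : ℝ) → Ω → Measure 𝕏)
    (hη : ∀ t, PoissonU.IsPoissonProcess (η t) (ENNReal.ofReal (t : ℝ) • Λ) P)
    (ℓ : ℕ) (m : Fin ℓ → ℕ) (hm : ∀ i, 1 ≤ m i)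
    (f : (i : Fin ℓ) → (Fin (m i) → 𝕏) → ℝ) (hf : ∀ i, PoissonU.IsL1Sym Λ (f i))
    (g : Fin ℓ → Set.Ioi (0 : ℝ) → ℝ) (hg : ∀ i, ∀ᶠ t in atTop, g i t ≠ 0)
    (hint : ∀ (k : ℕ), 1 ≤ k → ∀ (i : Fin k → Fin ℓ)
      (σ : Finpartition (Finset.univ : Finset (PoissonU.Diagram fun j ↦ m (i j)))),
      PoissonU.IsNonFlat σ →
      ∫⁻ y, ENNReal.ofReal (PoissonU.identify (PoissonU.tensor fun j x ↦ |f (i j) x|) σ y)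
        ∂(Measure.pi fun _ ↦ Λ) < ∞)
    -- `N` is a centred Gaussian vector with covariance matrix `(C_ij)`
    {Ω' : Type*} [MeasurableSpace Ω'] (P' : Measure Ω') [IsProbabilityMeasure P']
    (N : Ω' → EuclideanSpace ℝ (Fin ℓ)) (hN : HasGaussianLaw N P')
    (hN_mean : ∀ i, ∫ ω, N ω i ∂P' = 0)
    (hN_cov : ∀ i j, cov[fun ω ↦ N ω i, fun ω ↦ N ω j; P'] = PoissonU.asympCov Λ f i j) :
    (∀ i j, Tendsto (fun t : Set.Ioi (0 : ℝ) ↦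
        cov[PoissonU.normalizedUStat P t (g i t) (f i) (η t),
          PoissonU.normalizedUStat P t (g j t) (f j) (η t); P])
      atTop (𝓝 (PoissonU.asympCov Λ f i j))) ∧
    TendstoInDistribution
      (fun (t : Set.Ioi (0 : ℝ)) (ω : Ω) ↦
        WithLp.toLp 2 fun i ↦ PoissonU.normalizedUStat P t (g i t) (f i) (η t) ω)
      atTop N (fun _ ↦ P) P' := by
  have hff (i j : Fin ℓ) : PoissonU.PairIntegrable Λ (f i) (f j) :=
    PoissonU.pairIntegrable_of_lintegral_lt_top (n := fun k ↦ m (![i, j] k))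
      (f := fun k ↦ f (![i, j] k)) (fun k ↦ (hf _).measurable) (hint 2 one_le_two ![i, j])
  have hX (t : Set.Ioi (0 : ℝ)) (i : Fin ℓ) :
      MemLp (PoissonU.normalizedUStat P t (g i t) (f i) (η t)) 2 P :=
    (hη t).memLp_normalizedUStat (hf i) (hff i i) _ _
  have hXm (t : Set.Ioi (0 : ℝ)) : AEMeasurable (fun ω ↦
      WithLp.toLp 2 fun i ↦ PoissonU.normalizedUStat P t (g i t) (f i) (η t) ω) P :=
    (WithLp.measurable_toLp 2 _).comp_aemeasurable
      (aemeasurable_pi_lambda _ fun i ↦ (hX t i).aestronglyMeasurable.aemeasurable)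
  refine ⟨fun i j ↦ PoissonU.tendsto_covariance_normalizedUStat (hm i) (hm j) hη (hf i) (hf j)
    (hff i i) (hff j j) (hff i j) (hg i) (hg j), ⟨hXm, hN.aemeasurable, ?_⟩⟩
  have hNi (i : Fin ℓ) : MemLp (fun ω ↦ N ω i) 2 P' := by
    exact (EuclideanSpace.proj (𝕜 := ℝ) i).comp_memLp' hN.memLp_two
  have hcharN (v : EuclideanSpace ℝ (Fin ℓ)) : charFun (P'.map N) v
      = Complex.exp (-((∫ x, PoissonU.linearKernel Λ f v x ^ 2 ∂Λ) / 2 : ℝ)) := by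
    have hinner : (fun ω ↦ inner ℝ v (N ω)) = fun ω ↦ ∑ i, v i * N ω i := by
      ext ω
      simp [PiLp.inner_apply, mul_comm]
    have hvN (i : Fin ℓ) : MemLp (fun ω ↦ v i * N ω i) 2 P' := (hNi i).const_mul _
    have hmean : ∫ ω, ∑ i, v i * N ω i ∂P' = 0 := by
      rw [integral_finsetSum _ fun i _ ↦ (hvN i).integrable one_le_two]
      simp_rw [integral_const_mul, hN_mean]
      simp
    have hvar : Var[fun ω ↦ ∑ i, v i * N ω i; P']
        = ∫ x, PoissonU.linearKernel Λ f v x ^ 2 ∂Λ := by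
      rw [← covariance_self (Finset.aemeasurable_fun_sum _ fun i _ ↦
        (hvN i).aestronglyMeasurable.aemeasurable), covariance_fun_sum_fun_sum hvN hvN,
        PoissonU.integral_linearKernel_sq hm hf hff]
      simp_rw [covariance_const_mul_left, covariance_const_mul_right, hN_cov, mul_assoc]
    rw [hN.charFun_map_eq, hinner, hmean, hvar]
    congr 1
    push_cast
    ring
  -- Lévy's continuity theorem is applied along sequences `s n → ∞`
  refine tendsto_of_seq_tendsto fun s hs ↦ ?_
  refine ProbabilityMeasure.tendsto_of_tendsto_charFun fun v ↦ ?_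
  have hch (t : Set.Ioi (0 : ℝ)) : charFun (P.map fun ω ↦
      WithLp.toLp 2 fun i ↦ PoissonU.normalizedUStat P t (g i t) (f i) (η t) ω) v
      = ∫ ω, Complex.exp ((∑ i, v i * PoissonU.normalizedUStat P t (g i t) (f i) (η t) ω : ℝ)
        * Complex.I) ∂P := by
    rw [charFun_apply, integral_map (hXm t) (by fun_prop)]
    refine integral_congr_ae (ae_of_all _ fun ω ↦ ?_)
    simp [PiLp.inner_apply, mul_comm]
  have hlim := (PoissonU.tendsto_integral_cexp hη hm hf hff hg v).comp hs
  rw [← hcharN v] at hlim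
  exact hlim.congr fun n ↦ (hch (s n)).symm
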